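/- **Setting.** Let $S^1=\mathbb R/2\pi\mathbb Z$, $\mathbb D=\{(y,z):y^2+z^2<1\}$, $M=S^1\times\mathbb D$, and let $$f(x,y,z)=(\eta(x),\ \lambda(x,y)+u(x),\ \nu(x,y,z)+v(x)),\qquad \lambda(x,0)=\nu(x,0,0)=0,$$ be $2\pi$-periodic in $x$, with $\eta(0)=0$ and $\eta$ of degree $d>1$ (we also write $\eta$ for its lift to $\mathbb R$ with $\eta(0)=0$). Assume that $f$ is differentiable on $M$ with Hölder continuous differential, that $0<\nu'<\lambda'<1$ and $\eta'>1$, where $\nu'=\partial\nu/\partial z$, $\lambda'=\partial\lambda/\partial y$, that $f$ is injective on $M$, and that $\overline{f(M)}\subset M$. Put $\Lambda=\bigcap_{n\ge0}f^n(M)$ and, for $p\in\Lambda$, $W^u(p)=\{q\in\Lambda:\operatorname{dist}(f^{-n}p,f^{-n}q)\to0\}$. For $x\in S^1$ put $W^s_x=\{x\}\times\mathbb D$, and write $W^s(p)=W^s_x$ if $x=\pi_x(p)$. Representatives of angles are taken in $[0,2\pi)$. An *unstable line* is a continuous curve $\gamma:\mathbb R\to\Lambda$ with $\pi_x(\gamma(\tau))=\tau\bmod2\pi$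 and $\gamma(\tau)\in W^u(\gamma(\sigma))$ for all $\sigma,\tau\in\mathbb R$. For $p\in\Lambda$ let $\gamma_p$ be the unstable line that passes through $p$ at the representative of $\pi_x(p)$, and put $W^u_{[a,b]}(p)=\gamma_p([a,b])$. For $s,t\in\mathbb R$ the holonomy $h_{s,t}:W^s_s\cap\Lambda\to W^s_t\cap\Lambda$ sends $v$ to $\gamma(t)$, where $\gamma$ is the unstable line with $\gamma(s)=v$; for $x,x'\in S^1$, $h_{x,x'}$ is $h_{s,t}$ with $s,t\in[0,2\pi)$ representing $x,x'$. *Cylinders.* Let $0=a_0<\dots<a_d=2\pi$ be the points of $[0,2\pi]$ at which $\eta\in2\pi\mathbb Z$. Let $V_n(p)$ be the set of the points of $M$ whose first coordinate has the same itinerary of length $n$ under $\eta$ as $\pi_x(p)$, with respect to the arcs $[a_i,a_{i+1})$. The images under $f^{n+1}$ of the sets of points with a given itinerary of length $n+1$ are the horizontal cylinders of generation $n$; $H_n(p)$ is the one that contains $p$. The symbol $i_0$ of an unstable line $\gamma$ is the $i$ with $\gamma([0,2\pi))\subset f(\{\pi_x\in[a_i,a_{i+1})\})$. *Transversality assumption.*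 If $\gamma,\gamma'$ are unstable lines with different symbols $i_0$, then the $(x,y)$-projections of $\gamma$ and $\gamma'$ are transversal wherever they meet over $\tau\in[0,2\pi]$. *Strong Lipschitz points.* For $r>0$ let $\Gamma_r$ be the set of $(\tau,y)\in[-r,2\pi+r]\times\mathbb R$ at which the graphs of the $y$-coordinates of two unstable lines with different $i_0$ meet. Let $\eta_n(p)=\prod_{k=0}^{n}\eta'(\pi_x(f^kp))$. A point $p\in\Lambda$ is *strong locally Lipschitz with constant $L>0$* if for all large $n$, with $p_{-n}=f^{-n}(p)$ and $r=L\,\eta_n(p_{-n})^{-1}$, every $\tau\in[-r,2\pi+r]$ at which the graph of the $y$-coordinate of $\gamma_{p_{-n}}$ meets $\Gamma_r$ has distance at least $r$ in $\mathbb R$ from $\pi_x(V_n(p_{-n}))\subset[0,2\pi)$. It is *strong locally bi-Lipschitz with constant $L$* if all points of $W^u_{[0,2\pi]}(p)$ are strong locally Lipschitz with constant $L$. Let $L^s$ be the set of the points that are strong locally bi-Lipschitz with some constant $L>0$, and $L^s_x=L^s\cap W^s_x$. For $p\in\Lambda$, a constant $L_2$ and $n\ge 0$ say that the holonomies are *$L_2$-bi-Lipschitz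 at $p$ in $H_n(p)$* if for every $q\in W^u_{[0,2\pi]}(p)$, $q=\gamma_p(t)$ with $t\in[0,2\pi]$, and every $p'\in W^s(p)\cap H_n(p)\cap\Lambda$, with $s$ the representative of $\pi_x(p)$ and $\operatorname{dist}$ the Euclidean distance in $\mathbb D$, $$L_2^{-1}\operatorname{dist}(p,p')\le\operatorname{dist}(h_{s,t}(p),h_{s,t}(p'))\le L_2\operatorname{dist}(p,p').$$ **Theorem.** Under these assumptions: 1. For every $s\in\mathbb R$ and every $v\in\Lambda\cap W^s_s$ there is exactly one unstable line $\gamma$ with $\gamma(s)=v$. So the holonomies are well defined. 2. There is a constant $C\ge1$, depending only on $f$, such that for every $L_2>C$ there is $L_1>0$ such that for every point $p$ that is strong locally Lipschitz with constant $L_1$ (in particular, for every point that is strong locally bi-Lipschitz with constant $L_1$) there is $n(p)$ such that the holonomies are $L_2$-bi-Lipschitz at $p$ in $H_{n(p)}(p)$. In the linear diagonal case $\eta(x)=dx$, $\lambda(x,y)=\lambda y$, $\nu(x,y,z)=\nu z$ (with constant $\lambda,\nu$) one can take $C=1$. 3. For every $L_1>0$ there is $L_2\ge1$ such that for every point $p$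 that is strong locally Lipschitz with constant $L_1$ there is $n(p)$ such that the holonomies are $L_2$-bi-Lipschitz at $p$ in $H_{n(p)}(p)$. 4. $h_{x,x'}(L^s_x)=L^s_{x'}$ for all $x,x'\in S^1$. 5. The holonomies are locally Lipschitz on $L^s$: for every $p\in L^s$ with $x=\pi_x(p)$ there are $K>0$ and $\delta>0$ such that for all $x'\in S^1$ and all $p'\in W^s_x\cap\Lambda$ with $\operatorname{dist}(p,p')<\delta$, $$\operatorname{dist}(h_{x,x'}(p),h_{x,x'}(p'))\le K\operatorname{dist}(p,p').$$ -/

import Mathlib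

open Real Set Filter Topology
open scoped NNReal

noncomputable section

namespace Solenoid

instance factTwoPi : Fact (0 < 2 * π) := ⟨Real.two_pi_pos⟩

/-- The circle `S¹ = ℝ / 2πℤ`. -/
abbrev Circ : Type := AddCircle (2 * π)

/-- Points `(x, y, z)` of `S¹ × ℝ × ℝ`. -/
abbrev Pt : Type := Circ × ℝ × ℝ

/-- The representative in `[0, 2π)` of a point of the circle. -/
def rep (x : Circ) : ℝ := (AddCircle.equivIco (2 * π) 0 x : ℝ)

theorem coe_rep (x : Circ) : ((rep x : ℝ) : Circ) = x :=
  AddCircle.coe_equivIco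

/-- A `2π`-periodic function takes the same value at `x` and at the representative of `x`. -/
theorem periodic_rep {α : Type*} {g : ℝ → α} (hg : Function.Periodic g (2 * π)) (x : ℝ) :
    g (rep (x : Circ)) = g x := by
  have h1 : g (rep (x : Circ)) = hg.lift ((rep (x : Circ) : ℝ) : Circ) := (hg.lift_coe _).symm
  rw [h1, coe_rep]
  exact hg.lift_coe x

/-- The open solid torus `M = S¹ × 𝔻`. -/
def M : Set Pt := {p | p.2.1 ^ 2 + p.2.2 ^ 2 < 1}

/-- The universal cover `ℝ × 𝔻` of `M`. -/
def cover : Set (ℝ × ℝ × ℝ) := {p | p.2.1 ^ 2 + p.2.2 ^ 2 < 1}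

/-- The Euclidean distance of the `𝔻`-coordinates `(y, z)` of two points. -/
def discDist (p q : Pt) : ℝ := √((p.2.1 - q.2.1) ^ 2 + (p.2.2 - q.2.2) ^ 2)

/-- The disc `W^s_x = {x} × 𝔻`. -/
def Ws (x : Circ) : Set Pt := {p ∈ M | p.1 = x}

/-- The data of a lower triangular map
`f(x, y, z) = (η(x), λ(x, y) + u(x), ν(x, y, z) + v(x))` over a circle map of degree `d > 1`
fixing `0`. The map `η` is given by its lift to `ℝ`; the other functions are `2π`-periodic in `x`. -/
structure TriMap where
  d : ℕ
  one_lt_d : 1 < d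
  η : ℝ → ℝ
  lam : ℝ → ℝ → ℝ
  nu : ℝ → ℝ → ℝ → ℝ
  u : ℝ → ℝ
  v : ℝ → ℝ
  η_zero : η 0 = 0
  η_add : ∀ x, η (x + 2 * π) = η x + d * (2 * π)
  lam_periodic : Function.Periodic lam (2 * π)
  nu_periodic : Function.Periodic nu (2 * π)
  u_periodic : Function.Periodic u (2 * π)
  v_periodic : Function.Periodic v (2 * π)
  lam_zero : ∀ x, lam x 0 = 0
  nu_zero : ∀ x, nu x 0 0 = 0

namespace TriMap

variable (S : TriMap)

/-- The lift of the map to the universal cover. -/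
def lift (p : ℝ × ℝ × ℝ) : ℝ × ℝ × ℝ :=
  (S.η p.1, S.lam p.1 p.2.1 + S.u p.1, S.nu p.1 p.2.1 p.2.2 + S.v p.1)

/-- The map `f` itself. -/
def f (p : Pt) : Pt :=
  ((S.η (rep p.1) : Circ), S.lam (rep p.1) p.2.1 + S.u (rep p.1),
    S.nu (rep p.1) p.2.1 p.2.2 + S.v (rep p.1))

theorem coe_η_periodic : Function.Periodic (fun x : ℝ => (S.η x : Circ)) (2 * π) := by
  intro x
  have h : ((S.d * (2 * π) : ℝ) : Circ) = 0 := by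
    rw [← nsmul_eq_mul, AddCircle.coe_nsmul, AddCircle.coe_period, smul_zero]
  simp only [S.η_add, AddCircle.coe_add, h, add_zero]

/-- `f` is the map induced by `lift`: any real representative of the angle may be used. -/
theorem f_coe (x y z : ℝ) :
    S.f ((x : Circ), y, z) =
      (((S.lift (x, y, z)).1 : Circ), (S.lift (x, y, z)).2.1, (S.lift (x, y, z)).2.2) := by
  have h1 := periodic_rep S.coe_η_periodic x
  simp only [f, lift, h1, periodic_rep S.lam_periodic, periodic_rep S.nu_periodic,
    periodic_rep S.u_periodic, periodic_rep S.v_periodic]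

/-- The standing assumptions: `f` is of class `C^{1+ε}` on `M`, `0 < ν' < λ' < 1` and `η' > 1`
(with `ν' = ∂ν/∂z`, `λ' = ∂λ/∂y`), `f` is injective on `M`, and it maps `M` into a compact part
of `M`, so that `⋂ fⁿ(M)` is an attractor. -/
structure IsSolenoid : Prop where
  differentiable : ∀ p ∈ cover, DifferentiableAt ℝ S.lift p
  holder : ∃ C r : ℝ≥0, 0 < r ∧ HolderOnWith C r (fderiv ℝ S.lift) cover
  nu_pos : ∀ x y z, (x, y, z) ∈ cover → 0 < deriv (S.nu x y) z
  nu_lt_lam : ∀ x y z, (x, y, z) ∈ cover → deriv (S.nu x y) z < deriv (S.lam x) y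
  lam_lt_one : ∀ x y z, (x, y, z) ∈ cover → deriv (S.lam x) y < 1
  one_lt_eta : ∀ x, 1 < deriv S.η x
  injOn : InjOn S.f M
  attractor : closure (S.f '' M) ⊆ M

/-- The linear diagonal case `f(x, y, z) = (d x, λ y + u(x), ν z + v(x))`. -/
def IsLinear : Prop :=
  (∀ x, S.η x = S.d * x) ∧
    ∃ l n : ℝ, ∀ x y z, (x, y, z) ∈ cover → S.lam x y = l * y ∧ S.nu x y z = n * z

/-- The solenoid `Λ = ⋂ₙ fⁿ(M)`. -/
def Lam : Set Pt := ⋂ n : ℕ, S.f^[n] '' M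

/-- `f⁻ⁿ`, to be used on `Λ`. -/
def back (n : ℕ) (p : Pt) : Pt := (Function.invFunOn S.f M)^[n] p

/-- The global unstable manifold `W^u(p)`. -/
def Wu (p : Pt) : Set Pt :=
  {q ∈ S.Lam | Tendsto (fun n => dist (S.back n p) (S.back n q)) atTop (𝓝 0)}

/-- A global unstable manifold, parametrized over `ℝ` by the lift of the projection `π_x`. -/
structure IsUnstableLine (γ : ℝ → Pt) : Prop where
  continuous : Continuous γ
  proj : ∀ τ, (γ τ).1 = (τ : Circ)
  mem : ∀ τ, γ τ ∈ S.Lam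
  unstable : ∀ σ τ, γ τ ∈ S.Wu (γ σ)

/-- The arc `W^u_{[a, b]}(p)`, the part of `W^u(p)` over `[a, b]`, where `p` lies over the
representative of `π_x(p)` in `[0, 2π)`. Its points `q` are recorded together with the lift to
`[a, b]` of `π_x(q)`. -/
def WuArc (p : Pt) (a b : ℝ) : Set (ℝ × Pt) :=
  {t | t.1 ∈ Icc a b ∧ ∃ γ, S.IsUnstableLine γ ∧ γ (rep p.1) = p ∧ γ t.1 = t.2}

/-- The arc `[a_i, a_{i+1})` of the circle, where `a_0 = 0 < a_1 < ⋯ < a_d = 2π` are the lifts to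
`[0, 2π]` of the points of `η⁻¹(0)`. -/
def arc (i : ℕ) : Set Circ := {x | S.η (rep x) ∈ Ico (2 * π * i) (2 * π * (i + 1))}

/-- The vertical cylinder of a word `w` of length `n`: the set of the points of `M` whose first
coordinate has itinerary `w`. -/
def vert (n : ℕ) (w : Fin n → Fin S.d) : Set Pt :=
  {p ∈ M | ∀ k : Fin n, (S.f^[k] p).1 ∈ S.arc (w k)}

/-- The horizontal cylinder of generation `n` of a word of length `n + 1`. -/
def horiz (n : ℕ) (w : Fin (n + 1) → Fin S.d) : Set Pt := S.f^[n + 1] '' S.vert (n + 1) w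

/-- `V_n(p)`, the vertical cylinder of generation `n` that contains `p`. -/
def V (n : ℕ) (p : Pt) : Set Pt := {q | ∃ w, p ∈ S.vert n w ∧ q ∈ S.vert n w}

/-- `H_n(p)`, the horizontal cylinder of generation `n` that contains `p`. -/
def H (n : ℕ) (p : Pt) : Set Pt := {q | ∃ w, p ∈ S.horiz n w ∧ q ∈ S.horiz n w}

/-- The part over `[0, 2π)` of the unstable line `γ` lies in the horizontal cylinder of
generation `0` with symbol `i`, that is, `i_0 = i` for this line. -/
def HasSymbol (γ : ℝ → Pt) (i : Fin S.d) : Prop :=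
  ∀ τ ∈ Ico 0 (2 * π), γ τ ∈ S.horiz 0 (fun _ => i)

/-- Two unstable lines with different symbols `i_0`. -/
def DiffSymbol (γ γ' : ℝ → Pt) : Prop :=
  ∃ i j : Fin S.d, i ≠ j ∧ S.HasSymbol γ i ∧ S.HasSymbol γ' j

/-- The transversality assumption: the projections to the `(x, y)`-plane of two unstable arcs over
`[0, 2π]` with different symbols `i_0` have no common tangent at a point where they meet. -/
def Transversal : Prop :=
  ∀ γ γ' : ℝ → Pt, S.IsUnstableLine γ → S.IsUnstableLine γ' → S.DiffSymbol γ γ' →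
    ∀ τ ∈ Icc 0 (2 * π), (γ τ).2.1 = (γ' τ).2.1 →
      ∀ m : ℝ, ¬ (HasDerivAt (fun t => (γ t).2.1) m τ ∧ HasDerivAt (fun t => (γ' t).2.1) m τ)

/-- `Γ`: the intersection points of the `(x, y)`-projections of unstable arcs over
`[-r, 2π + r]` with different symbols `i_0`, with the first coordinate lifted to `[-r, 2π + r]`. -/
def Gam (r : ℝ) : Set (ℝ × ℝ) :=
  {t | t.1 ∈ Icc (-r) (2 * π + r) ∧ ∃ γ γ', S.IsUnstableLine γ ∧ S.IsUnstableLine γ' ∧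
    S.DiffSymbol γ γ' ∧ (γ t.1).2.1 = t.2 ∧ (γ' t.1).2.1 = t.2}

/-- `η_n(p) = η'(p) η'(f(p)) ⋯ η'(fⁿ(p))`. -/
def etaProd (n : ℕ) (p : Pt) : ℝ :=
  ∏ k ∈ Finset.range (n + 1), deriv S.η (rep (S.f^[k] p).1)

/-- `p` is strong locally Lipschitz with constant `L`: for all large `n`, with
`r = L / η_n(f⁻ⁿ(p))`, the distance between `V_n(f⁻ⁿ(p))` and the points of `Γ` on the projection of
`W^u_{[-r, 2π + r]}(f⁻ⁿ(p))`, measured between the projections by `π_x` in `ℝ`, is at least `r`. -/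
def StrongLip (L : ℝ) (p : Pt) : Prop :=
  p ∈ S.Lam ∧ ∀ᶠ n : ℕ in atTop, ∀ r : ℝ, r = L * (S.etaProd n (S.back n p))⁻¹ →
    ∀ a ∈ S.V n (S.back n p), ∀ t ∈ S.WuArc (S.back n p) (-r) (2 * π + r),
      (t.1, t.2.2.1) ∈ S.Gam r → r ≤ |rep a.1 - t.1|

/-- `p` is strong locally bi-Lipschitz with constant `L`: all points of `W^u_{[0, 2π]}(p)` are
strong locally Lipschitz with constant `L`. -/
def StrongBiLip (L : ℝ) (p : Pt) : Prop :=
  S.StrongLip L p ∧ ∀ t ∈ S.WuArc p 0 (2 * π), S.StrongLip L t.2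

/-- `L^s`, the set of the strong locally bi-Lipschitz points. -/
def Ls : Set Pt := {p | ∃ L > 0, S.StrongBiLip L p}

open Classical in
/-- The holonomy `h_{s,t}` along the unstable lamination from `W^s_s ∩ Λ` to `W^s_t ∩ Λ`, for real
`s` and `t`. -/
def hol (s t : ℝ) (v : Pt) : Pt :=
  if h : ∃ γ, S.IsUnstableLine γ ∧ γ s = v then h.choose t else v

/-- For every `q ∈ W^u_{[0, 2π]}(p)`, lying over `t ∈ [0, 2π]`, the holonomy from `W^s(p) ∩ Λ` to
`W^s(q) ∩ Λ` satisfies the bi-Lipschitz inequalities with constant `L` at `p` within `H_n(p)`. -/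
def HolBiLipAt (L : ℝ) (n : ℕ) (p : Pt) : Prop :=
  ∀ t ∈ Icc 0 (2 * π), ∀ p' ∈ Ws p.1 ∩ S.H n p ∩ S.Lam,
    L⁻¹ * discDist p p' ≤ discDist (S.hol (rep p.1) t p) (S.hol (rep p.1) t p') ∧
      discDist (S.hol (rep p.1) t p) (S.hol (rep p.1) t p') ≤ L * discDist p p'

end TriMap

end Solenoid

end

/-!
The proof codes unstable lines by symbol sequences, and compares two lines at the level at which
their codes separate.

*Unstable lines.* The closure of `f(M)` is compact in `M`, so the differential of `f` satisfies
uniform estimates on a closed tube that contains the solenoid (`exists_bounds`). A code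
`m : ℕ → Fin d` selects inverse branches of the lift of `η`, hence the first coordinates `G m k τ`
of a backward orbit of `τ`. Since `f` contracts fibres, exactly one point `line m τ` of the
solenoid has a backward orbit over these coordinates (`line_spec`, `eq_line`), and it is Lipschitz
in `τ`. Every unstable line is one of these lines, because its preimages are lifts of the same
paths along the circle map (`eq_line_of_isUnstableLine`). All quantitative statements about lines
come from one remark: a bounded sequence with `e k ≤ q e (k + 1) + c`, `q < 1`, satisfies
`e 0 ≤ c / (1 - q)`.

*Transversality.* The slope of the `y`-coordinate along unstable lines is a continuous function on
the solenoid, the fixed point of a contraction (`exists_invariant_slope`, `hasDerivAt_line`). By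
compactness, the transversality assumption becomes uniform, and two lines with different symbols
that are closer than `c r` over a point cross at a distance less than `r` (`exists_crossing`).

*Holonomies.* Let `p` and `p'` lie in one disc, and let `N` be the first index at which their codes
differ. The preimages of order `N` of their lines have different symbols. If `p` is strong
Lipschitz with constant `L`, these lines do not cross within a distance `r` of the base interval
of generation `N`, where `r / L` is comparable to the length of this interval; hence the
difference of their `y`-coordinates is at least `c r`, and over the interval the differences of
both coordinates vary by at most a multiple `O(1 / L)` of it (`exists_relative_variation`).
Applying `f` to the power `N` transports these differences by products of averaged triangular
differentials. The products over two points of the base are comparable, by bounded distortion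
(`prod_segAvg_le`), and the off-diagonal terms are controlled because `ν' ≤ κ λ'` with `κ < 1`
(`abs_sub_prod_mul_le`). This bounds the ratio of the distances of the two lines over any two
points of `[0, 2π]` (`exists_biLip`). In the linear diagonal case the products are constant, and
the ratio is `1 + O(1 / L)` (`exists_biLip_of_isLinear`).

The set of strong bi-Lipschitz points is invariant under holonomies since the defining condition
refers to a whole arc (`hol_mem_Ls`), and points near `p` in its disc lie in a given horizontal
cylinder of `p` (`exists_mem_H`).
-/

noncomputable section

namespace Solenoid

/-! ### The entries of the differential and uniform constants -/

/-- The closed solid tube `y² + z² ≤ ρ²` in the universal cover. -/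
def slab (ρ : ℝ) : Set (ℝ × ℝ × ℝ) := {p | p.2.1 ^ 2 + p.2.2 ^ 2 ≤ ρ ^ 2}

theorem slab_subset_cover {ρ : ℝ} (h0 : 0 ≤ ρ) (h1 : ρ < 1) : slab ρ ⊆ cover := by
  intro p hp
  simp only [slab, cover, mem_ofPred_eq] at *
  nlinarith

theorem convex_slab (ρ : ℝ) : Convex ℝ (slab ρ) := by
  intro p hp q hq a b ha hb hab
  simp only [slab, mem_ofPred_eq, Prod.snd_add, Prod.smul_snd, Prod.fst_add, Prod.smul_fst,
    smul_eq_mul] at *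
  obtain rfl : b = 1 - a := by linarith
  nlinarith [mul_nonneg (mul_nonneg ha hb) (add_nonneg (sq_nonneg (p.2.1 - q.2.1))
    (sq_nonneg (p.2.2 - q.2.2))), mul_le_mul_of_nonneg_left hp ha, mul_le_mul_of_nonneg_left hq hb]

theorem isOpen_cover : IsOpen cover :=
  isOpen_lt (by fun_prop) continuous_const

namespace TriMap

variable (S : TriMap)

/-- `∂η/∂x`, as an entry of the differential of the lift. -/
def dxx (P : ℝ × ℝ × ℝ) : ℝ := (fderiv ℝ S.lift P (1, 0, 0)).1
/-- `∂(λ + u)/∂x`. -/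
def dyx (P : ℝ × ℝ × ℝ) : ℝ := (fderiv ℝ S.lift P (1, 0, 0)).2.1
/-- `∂λ/∂y`. -/
def dyy (P : ℝ × ℝ × ℝ) : ℝ := (fderiv ℝ S.lift P (0, 1, 0)).2.1
/-- `∂(ν + v)/∂x`. -/
def dzx (P : ℝ × ℝ × ℝ) : ℝ := (fderiv ℝ S.lift P (1, 0, 0)).2.2
/-- `∂ν/∂y`. -/
def dzy (P : ℝ × ℝ × ℝ) : ℝ := (fderiv ℝ S.lift P (0, 1, 0)).2.2
/-- `∂ν/∂z`. -/
def dzz (P : ℝ × ℝ × ℝ) : ℝ := (fderiv ℝ S.lift P (0, 0, 1)).2.2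

variable {S}

namespace IsSolenoid

theorem hasDerivAt_lift_curve (hS : S.IsSolenoid) {c : ℝ → ℝ × ℝ × ℝ} {v : ℝ × ℝ × ℝ} {t : ℝ}
    (hc : HasDerivAt c v t) (hct : c t ∈ cover) :
    HasDerivAt (fun s => S.η (c s).1) (fderiv ℝ S.lift (c t) v).1 t ∧
    HasDerivAt (fun s => S.lam (c s).1 (c s).2.1 + S.u (c s).1) (fderiv ℝ S.lift (c t) v).2.1 t ∧
    HasDerivAt (fun s => S.nu (c s).1 (c s).2.1 (c s).2.2 + S.v (c s).1)
      (fderiv ℝ S.lift (c t) v).2.2 t := by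
  have h := (hS.differentiable _ hct).hasFDerivAt.comp_hasDerivAt t hc
  have h1 := (ContinuousLinearMap.fst ℝ ℝ (ℝ × ℝ)).hasFDerivAt.comp_hasDerivAt t h
  have h2 := (ContinuousLinearMap.snd ℝ ℝ (ℝ × ℝ)).hasFDerivAt.comp_hasDerivAt t h
  have h3 := (ContinuousLinearMap.fst ℝ ℝ ℝ).hasFDerivAt.comp_hasDerivAt t h2
  have h4 := (ContinuousLinearMap.snd ℝ ℝ ℝ).hasFDerivAt.comp_hasDerivAt t h2
  exact ⟨h1, h3, h4⟩

theorem hasDerivAt_x (x y z : ℝ) :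
    HasDerivAt (fun s : ℝ => (s, y, z)) ((1 : ℝ), (0 : ℝ), (0 : ℝ)) x :=
  (hasDerivAt_id x).prodMk (hasDerivAt_const x _)

theorem hasDerivAt_y (x y z : ℝ) :
    HasDerivAt (fun s : ℝ => (x, s, z)) ((0 : ℝ), (1 : ℝ), (0 : ℝ)) y :=
  (hasDerivAt_const y _).prodMk ((hasDerivAt_id y).prodMk (hasDerivAt_const y _))

theorem hasDerivAt_z (x y z : ℝ) :
    HasDerivAt (fun s : ℝ => (x, y, s)) ((0 : ℝ), (0 : ℝ), (1 : ℝ)) z :=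
  (hasDerivAt_const z _).prodMk ((hasDerivAt_const z _).prodMk (hasDerivAt_id z))

theorem mem_cover_zero (x : ℝ) : (x, (0 : ℝ), (0 : ℝ)) ∈ cover := by simp [cover]

theorem dxx_eq (hS : S.IsSolenoid) {P : ℝ × ℝ × ℝ} (hP : P ∈ cover) :
    S.dxx P = deriv S.η P.1 :=
  (hS.hasDerivAt_lift_curve (hasDerivAt_x P.1 P.2.1 P.2.2) hP).1.deriv.symm

theorem hasDerivAt_η (hS : S.IsSolenoid) (x : ℝ) : HasDerivAt S.η (deriv S.η x) x := by
  have := (hS.hasDerivAt_lift_curve (hasDerivAt_x x 0 0) (mem_cover_zero x)).1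
  exact this.differentiableAt.hasDerivAt

theorem dyy_eq (hS : S.IsSolenoid) {P : ℝ × ℝ × ℝ} (hP : P ∈ cover) :
    S.dyy P = deriv (S.lam P.1) P.2.1 := by
  have := (hS.hasDerivAt_lift_curve (hasDerivAt_y P.1 P.2.1 P.2.2) hP).2.1
  have := this.sub_const (S.u P.1)
  simp only [add_sub_cancel_right] at this
  exact this.deriv.symm

theorem dzz_eq (hS : S.IsSolenoid) {P : ℝ × ℝ × ℝ} (hP : P ∈ cover) :
    S.dzz P = deriv (S.nu P.1 P.2.1) P.2.2 := by
  have := (hS.hasDerivAt_lift_curve (hasDerivAt_z P.1 P.2.1 P.2.2) hP).2.2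
  have := this.sub_const (S.v P.1)
  simp only [add_sub_cancel_right] at this
  exact this.deriv.symm

/-- The differential of the lift is lower triangular. -/
theorem fderiv_lift_apply (hS : S.IsSolenoid) {P : ℝ × ℝ × ℝ} (hP : P ∈ cover)
    (v : ℝ × ℝ × ℝ) :
    fderiv ℝ S.lift P v = (S.dxx P * v.1, S.dyx P * v.1 + S.dyy P * v.2.1,
      S.dzx P * v.1 + S.dzy P * v.2.1 + S.dzz P * v.2.2) := by
  have hy := (hS.hasDerivAt_lift_curve (hasDerivAt_y P.1 P.2.1 P.2.2) hP).1
  have hz := hS.hasDerivAt_lift_curve (hasDerivAt_z P.1 P.2.1 P.2.2) hP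
  have e1 : (fderiv ℝ S.lift P (0, 1, 0)).1 = 0 := hy.unique (hasDerivAt_const P.2.1 (S.η P.1))
  have e2 : (fderiv ℝ S.lift P (0, 0, 1)).1 = 0 := hz.1.unique (hasDerivAt_const P.2.2 (S.η P.1))
  have e3 : (fderiv ℝ S.lift P (0, 0, 1)).2.1 = 0 := 
    hz.2.1.unique (hasDerivAt_const P.2.2 (S.lam P.1 P.2.1 + S.u P.1))
  have hv : v = v.1 • ((1 : ℝ), (0 : ℝ), (0 : ℝ)) + v.2.1 • ((0 : ℝ), (1 : ℝ), (0 : ℝ)) +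
      v.2.2 • ((0 : ℝ), (0 : ℝ), (1 : ℝ)) := by
    ext <;> simp
  conv_lhs => rw [hv]
  simp only [map_add, map_smul]
  ext
  · simp [e1, e2, dxx, mul_comm]
  · simp [e3, dyx, dyy, mul_comm]
  · simp [dzx, dzy, dzz, mul_comm]

theorem fderiv_periodic (S : TriMap) (x y z : ℝ) :
    fderiv ℝ S.lift (x + 2 * π, y, z) = fderiv ℝ S.lift (x, y, z) := by
  have h : (fun P => S.lift (P + (2 * π, 0, 0))) =
      fun P => S.lift P + (S.d * (2 * π), 0, 0) := by
    funext P
    ext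
    · simp [lift, S.η_add]
    · simp [lift, S.lam_periodic P.1, S.u_periodic P.1]
    · simp [lift, S.nu_periodic P.1, S.v_periodic P.1]
  have h1 := fderiv_comp_add_right (𝕜 := ℝ) (f := S.lift) (x := (x, y, z)) (2 * π, 0, 0)
  rw [h, fderiv_add_const] at h1
  rw [h1]
  simp

theorem continuousOn_fderiv (hS : S.IsSolenoid) : ContinuousOn (fderiv ℝ S.lift) cover := by
  obtain ⟨C, r, hr, h⟩ := hS.holder
  exact h.continuousOn hr

end IsSolenoid

/-- A periodic continuous function on the universal cover attains its maximum on a slab. -/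
theorem exists_forall_slab_le {ρ : ℝ} (h0 : 0 ≤ ρ) (h1 : ρ < 1) {g : ℝ × ℝ × ℝ → ℝ}
    (hg : ContinuousOn g cover) (hp : ∀ x y z, g (x + 2 * π, y, z) = g (x, y, z)) :
    ∃ P ∈ slab ρ, ∀ Q ∈ slab ρ, g Q ≤ g P := by
  have hclosed : IsClosed (slab ρ) := isClosed_le (by fun_prop) continuous_const
  have hcomp : IsCompact (slab ρ ∩ Icc 0 (2 * π) ×ˢ Icc (-1) 1 ×ˢ Icc (-1) 1) :=
    (isCompact_Icc.prod (isCompact_Icc.prod isCompact_Icc)).inter_left hclosed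
  obtain ⟨P, hP, hmax⟩ := hcomp.exists_isMaxOn
    ⟨(0, 0, 0), by simp [slab, sq_nonneg], by simp [Real.pi_pos.le]⟩
    (hg.mono (inter_subset_left.trans (slab_subset_cover h0 h1)))
  refine ⟨P, hP.1, fun Q hQ => ?_⟩
  obtain ⟨x, hx, hxQ⟩ := Function.Periodic.exists_mem_Ico₀
    (f := fun x => g (x, Q.2.1, Q.2.2)) (fun x => hp x _ _) Real.two_pi_pos Q.1
  have : g Q = g (x, Q.2.1, Q.2.2) := hxQ
  rw [this]
  have hQ' : Q.2.1 ^ 2 + Q.2.2 ^ 2 ≤ ρ ^ 2 := hQ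
  refine hmax ⟨hQ, ⟨hx.1, hx.2.le⟩, ?_, ?_⟩
  · exact abs_le.1 ((sq_le_one_iff_abs_le_one _).1 (by nlinarith [sq_nonneg Q.2.2]))
  · exact abs_le.1 ((sq_le_one_iff_abs_le_one _).1 (by nlinarith [sq_nonneg Q.2.1]))

/-- A function on a slab that is bounded by `B` and Hölder with constant `H` and exponent `α`. -/
structure Tame (ρ B H α : ℝ) (g : ℝ × ℝ × ℝ → ℝ) : Prop where
  abs_le : ∀ P ∈ slab ρ, |g P| ≤ B
  holder : ∀ P ∈ slab ρ, ∀ Q ∈ slab ρ, |g P - g Q| ≤ H * dist P Q ^ α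

/-- Uniform constants for `f` on a slab that contains a lift of `f(M)`. -/
structure Bounds (S : TriMap) where
  (ρ μ B ℓ a₀ c₀ κ H α : ℝ)
  ρ_nonneg : 0 ≤ ρ
  ρ_lt : ρ < 1
  maps : ∀ p ∈ M, (S.f p).2.1 ^ 2 + (S.f p).2.2 ^ 2 ≤ ρ ^ 2
  one_lt_μ : 1 < μ
  le_dxx : ∀ P ∈ slab ρ, μ ≤ S.dxx P
  a₀_pos : 0 < a₀
  c₀_pos : 0 < c₀
  ℓ_lt : ℓ < 1
  κ_lt : κ < 1
  le_dyy : ∀ P ∈ slab ρ, a₀ ≤ S.dyy P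
  dyy_le : ∀ P ∈ slab ρ, S.dyy P ≤ ℓ
  le_dzz : ∀ P ∈ slab ρ, c₀ ≤ S.dzz P
  dzz_le : ∀ P ∈ slab ρ, S.dzz P ≤ κ * S.dyy P
  H_nonneg : 0 ≤ H
  α_pos : 0 < α
  xx : Tame ρ B H α S.dxx
  yx : Tame ρ B H α S.dyx
  yy : Tame ρ B H α S.dyy
  zx : Tame ρ B H α S.dzx
  zy : Tame ρ B H α S.dzy
  zz : Tame ρ B H α S.dzz

namespace IsSolenoid

/-- `f` maps `M` into a smaller closed solid torus, because the closure of `f(M)` is a compact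
part of `M`. -/
theorem exists_radius (hS : S.IsSolenoid) :
    ∃ ρ : ℝ, 0 ≤ ρ ∧ ρ < 1 ∧ ∀ p ∈ M, (S.f p).2.1 ^ 2 + (S.f p).2.2 ^ 2 ≤ ρ ^ 2 := by
  have hMsub : M ⊆ univ ×ˢ Icc (-1) 1 ×ˢ Icc (-1) 1 := by
    intro p hp
    have hp' : p.2.1 ^ 2 + p.2.2 ^ 2 < 1 := hp
    refine ⟨trivial, ?_, ?_⟩
    · exact abs_le.1 ((sq_le_one_iff_abs_le_one _).1 (by nlinarith [sq_nonneg p.2.2]))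
    · exact abs_le.1 ((sq_le_one_iff_abs_le_one _).1 (by nlinarith [sq_nonneg p.2.1]))
  have hbox : IsCompact ((univ : Set Circ) ×ˢ Icc (-1 : ℝ) 1 ×ˢ Icc (-1 : ℝ) 1) :=
    isCompact_univ.prod (isCompact_Icc.prod isCompact_Icc)
  have hcomp : IsCompact (closure (S.f '' M)) :=
    hbox.of_isClosed_subset isClosed_closure (hS.attractor.trans hMsub)
  have h0 : ((0 : Circ), (0 : ℝ), (0 : ℝ)) ∈ M := by simp [M]
  obtain ⟨p, hp, hmax⟩ := hcomp.exists_isMaxOn ⟨_, subset_closure (mem_image_of_mem _ h0)⟩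
    (f := fun p : Pt => p.2.1 ^ 2 + p.2.2 ^ 2) (by fun_prop)
  have hpM : p.2.1 ^ 2 + p.2.2 ^ 2 < 1 := hS.attractor hp
  refine ⟨√(p.2.1 ^ 2 + p.2.2 ^ 2), Real.sqrt_nonneg _, ?_, fun q hq => ?_⟩
  · rw [Real.sqrt_lt' one_pos]; simpa using hpM
  · rw [Real.sq_sqrt (by positivity)]
    exact hmax (subset_closure (mem_image_of_mem _ hq))

theorem exists_bounds (hS : S.IsSolenoid) : Nonempty (Bounds S) := by
  obtain ⟨ρ, h0, h1, hmaps⟩ := hS.exists_radius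
  have hsub := slab_subset_cover h0 h1
  obtain ⟨C, r, hr, hold⟩ := hS.holder
  have hD := hS.continuousOn_fderiv
  have hDp := fderiv_periodic S
  have hDv : ∀ v, ContinuousOn (fun P => fderiv ℝ S.lift P v) cover := fun v =>
    hD.clm_apply continuousOn_const
  obtain ⟨P1, hP1, hm1⟩ := exists_forall_slab_le h0 h1 (g := fun P => -S.dxx P)
    (hDv (1, 0, 0)).fst.neg (fun x y z => by simp [dxx, hDp])
  obtain ⟨P2, hP2, hm2⟩ := exists_forall_slab_le h0 h1 (g := fun P => -S.dyy P)
    (hDv (0, 1, 0)).snd.fst.neg (fun x y z => by simp [dyy, hDp])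
  obtain ⟨P3, hP3, hm3⟩ := exists_forall_slab_le h0 h1 (g := fun P => S.dyy P)
    (hDv (0, 1, 0)).snd.fst (fun x y z => by simp [dyy, hDp])
  obtain ⟨P4, hP4, hm4⟩ := exists_forall_slab_le h0 h1 (g := fun P => -S.dzz P)
    (hDv (0, 0, 1)).snd.snd.neg (fun x y z => by simp [dzz, hDp])
  have hzpos : ∀ P ∈ cover, 0 < S.dzz P := fun P hP => by
    rw [hS.dzz_eq hP]; exact hS.nu_pos _ _ _ hP
  have hzy : ∀ P ∈ cover, S.dzz P < S.dyy P := fun P hP => by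
    rw [hS.dzz_eq hP, hS.dyy_eq hP]; exact hS.nu_lt_lam _ _ _ hP
  have hypos : ∀ P ∈ cover, 0 < S.dyy P := fun P hP => (hzpos P hP).trans (hzy P hP)
  obtain ⟨P5, hP5, hm5⟩ := exists_forall_slab_le h0 h1 (g := fun P => S.dzz P / S.dyy P)
    ((hDv (0, 0, 1)).snd.snd.div (hDv (0, 1, 0)).snd.fst (fun P hP => (hypos P hP).ne'))
    (fun x y z => by simp [dzz, dyy, hDp])
  obtain ⟨P6, hP6, hm6⟩ := exists_forall_slab_le h0 h1 (g := fun P => ‖fderiv ℝ S.lift P‖)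
    hD.norm (fun x y z => by simp [hDp])
  have key : ∀ (v : ℝ × ℝ × ℝ) (φ : (ℝ × ℝ × ℝ) →ₗ[ℝ] ℝ), ‖v‖ ≤ 1 → (∀ w, |φ w| ≤ ‖w‖) →
      Tame ρ ‖fderiv ℝ S.lift P6‖ C r (fun P => φ (fderiv ℝ S.lift P v)) := by
    intro v φ hv hφ
    constructor
    · intro P hP
      refine (hφ _).trans (((fderiv ℝ S.lift P).le_opNorm v).trans ?_)
      calc _ ≤ ‖fderiv ℝ S.lift P‖ * 1 := by gcongr
        _ ≤ _ := by rw [mul_one]; exact hm6 P hP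
    · intro P hP Q hQ
      rw [← map_sub, ← sub_apply]
      refine (hφ _).trans (((fderiv ℝ S.lift P - fderiv ℝ S.lift Q).le_opNorm v).trans ?_)
      calc _ ≤ ‖fderiv ℝ S.lift P - fderiv ℝ S.lift Q‖ * 1 := by gcongr
        _ ≤ _ := by
          rw [mul_one, ← dist_eq_norm]
          exact hold.dist_le (hsub hP) (hsub hQ)
  have n1 : ‖((1 : ℝ), (0 : ℝ), (0 : ℝ))‖ ≤ 1 := by simp
  have n2 : ‖((0 : ℝ), (1 : ℝ), (0 : ℝ))‖ ≤ 1 := by simp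
  have n3 : ‖((0 : ℝ), (0 : ℝ), (1 : ℝ))‖ ≤ 1 := by simp
  have f1 : ∀ w : ℝ × ℝ × ℝ, |LinearMap.fst ℝ ℝ (ℝ × ℝ) w| ≤ ‖w‖ := fun w => norm_fst_le w
  have f2 : ∀ w : ℝ × ℝ × ℝ,
      |(LinearMap.fst ℝ ℝ ℝ ∘ₗ LinearMap.snd ℝ ℝ (ℝ × ℝ)) w| ≤ ‖w‖ := fun w =>
    (norm_fst_le w.2).trans (norm_snd_le w)
  have f3 : ∀ w : ℝ × ℝ × ℝ,
      |(LinearMap.snd ℝ ℝ ℝ ∘ₗ LinearMap.snd ℝ ℝ (ℝ × ℝ)) w| ≤ ‖w‖ := fun w =>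
    (norm_snd_le w.2).trans (norm_snd_le w)
  exact ⟨{
    ρ := ρ, μ := S.dxx P1, B := ‖fderiv ℝ S.lift P6‖, ℓ := S.dyy P3, a₀ := S.dyy P2,
    c₀ := S.dzz P4, κ := S.dzz P5 / S.dyy P5, H := C, α := r
    ρ_nonneg := h0
    ρ_lt := h1
    maps := hmaps
    one_lt_μ := by rw [hS.dxx_eq (hsub hP1)]; exact hS.one_lt_eta _
    le_dxx := fun P hP => neg_le_neg_iff.1 (hm1 P hP)
    a₀_pos := hypos _ (hsub hP2)
    c₀_pos := hzpos _ (hsub hP4)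
    ℓ_lt := by rw [hS.dyy_eq (hsub hP3)]; exact hS.lam_lt_one _ _ _ (hsub hP3)
    κ_lt := (div_lt_one (hypos _ (hsub hP5))).2 (hzy _ (hsub hP5))
    le_dyy := fun P hP => neg_le_neg_iff.1 (hm2 P hP)
    dyy_le := hm3
    le_dzz := fun P hP => neg_le_neg_iff.1 (hm4 P hP)
    dzz_le := fun P hP => (div_le_iff₀ (hypos _ (hsub hP))).1 (hm5 P hP)
    H_nonneg := C.2
    α_pos := hr
    xx := key _ _ n1 f1
    yx := key _ _ n1 f2
    yy := key _ _ n2 f2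
    zx := key _ _ n1 f3
    zy := key _ _ n2 f3
    zz := key _ _ n3 f3 }⟩

end IsSolenoid

end TriMap

/-! ### Averages along segments and the fibre contraction -/

/-- The average of `g` over the segment from `P` to `Q`. -/
def segAvg (g : ℝ × ℝ × ℝ → ℝ) (P Q : ℝ × ℝ × ℝ) : ℝ :=
  ∫ s in (0 : ℝ)..1, g (AffineMap.lineMap P Q s)

theorem segAvg_self (g : ℝ × ℝ × ℝ → ℝ) (P : ℝ × ℝ × ℝ) : segAvg g P P = g P := by
  simp [segAvg]

theorem lineMap_mem_slab {ρ : ℝ} {P Q : ℝ × ℝ × ℝ} (hP : P ∈ slab ρ) (hQ : Q ∈ slab ρ) {s : ℝ}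
    (hs : s ∈ Icc (0 : ℝ) 1) : AffineMap.lineMap P Q s ∈ slab ρ :=
  (convex_slab ρ).lineMap_mem hP hQ hs

theorem dist_lineMap_le {P Q P' Q' : ℝ × ℝ × ℝ} {δ s : ℝ} (h1 : dist P P' ≤ δ)
    (h2 : dist Q Q' ≤ δ) (hs : s ∈ Icc (0 : ℝ) 1) :
    dist (AffineMap.lineMap P Q s : ℝ × ℝ × ℝ) (AffineMap.lineMap P' Q' s) ≤ δ := by
  have h := (convex_closedBall (0 : ℝ × ℝ × ℝ) δ)
    (x := P - P') (by simpa [← dist_eq_norm] using h1)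
    (y := Q - Q') (by simpa [← dist_eq_norm] using h2)
    (a := 1 - s) (b := s) (by linarith [hs.2]) hs.1 (by ring)
  rw [mem_closedBall_zero_iff] at h
  rw [dist_eq_norm, AffineMap.lineMap_apply_module, AffineMap.lineMap_apply_module]
  have e : (1 - s) • P + s • Q - ((1 - s) • P' + s • Q') = (1 - s) • (P - P') + s • (Q - Q') := by
    module
  rwa [e]

namespace TriMap

namespace Tame

variable {ρ B H α : ℝ} {g : ℝ × ℝ × ℝ → ℝ}

theorem continuousOn (hg : Tame ρ B H α g) (hα : 0 < α) : ContinuousOn g (slab ρ) := by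
  intro P hP
  rw [ContinuousWithinAt, tendsto_iff_dist_tendsto_zero]
  have h : Tendsto (fun Q => H * dist Q P ^ α) (𝓝[slab ρ] P) (𝓝 0) := by
    have h1 : Tendsto (fun Q => dist Q P) (𝓝[slab ρ] P) (𝓝 0) :=
      (tendsto_iff_dist_tendsto_zero.1 tendsto_id).mono_left nhdsWithin_le_nhds
    have h2 := (h1.rpow_const (p := α) (Or.inr hα.le)).const_mul H
    simpa [Real.zero_rpow hα.ne'] using h2
  refine squeeze_zero' (Eventually.of_forall fun _ => dist_nonneg) ?_ h
  filter_upwards [self_mem_nhdsWithin] with Q hQ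
  exact hg.holder Q hQ P hP

theorem intervalIntegrable (hg : Tame ρ B H α g) (hα : 0 < α) {P Q : ℝ × ℝ × ℝ}
    (hP : P ∈ slab ρ) (hQ : Q ∈ slab ρ) :
    IntervalIntegrable (fun s : ℝ => g (AffineMap.lineMap P Q s)) MeasureTheory.volume 0 1 := by
  refine ContinuousOn.intervalIntegrable ?_
  rw [uIcc_of_le zero_le_one]
  exact (hg.continuousOn hα).comp AffineMap.lineMap_continuous.continuousOn
    fun s hs => lineMap_mem_slab hP hQ hs

theorem segAvg_le (hg : Tame ρ B H α g) (hα : 0 < α) {P Q : ℝ × ℝ × ℝ}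
    (hP : P ∈ slab ρ) (hQ : Q ∈ slab ρ) {c : ℝ} (hc : ∀ R ∈ slab ρ, g R ≤ c) :
    segAvg g P Q ≤ c := by
  have := intervalIntegral.integral_mono_on zero_le_one (hg.intervalIntegrable hα hP hQ)
    (intervalIntegrable_const (c := c)) fun s hs => hc _ (lineMap_mem_slab hP hQ hs)
  simpa [segAvg] using this

theorem le_segAvg (hg : Tame ρ B H α g) (hα : 0 < α) {P Q : ℝ × ℝ × ℝ}
    (hP : P ∈ slab ρ) (hQ : Q ∈ slab ρ) {c : ℝ} (hc : ∀ R ∈ slab ρ, c ≤ g R) :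
    c ≤ segAvg g P Q := by
  have := intervalIntegral.integral_mono_on zero_le_one
    (intervalIntegrable_const (c := c)) (hg.intervalIntegrable hα hP hQ)
    fun s hs => hc _ (lineMap_mem_slab hP hQ hs)
  simpa [segAvg] using this

theorem segAvg_le_mul (hg : Tame ρ B H α g) {g' : ℝ × ℝ × ℝ → ℝ} (hg' : Tame ρ B H α g')
    (hα : 0 < α) {P Q : ℝ × ℝ × ℝ} (hP : P ∈ slab ρ) (hQ : Q ∈ slab ρ) {c : ℝ}
    (hc : ∀ R ∈ slab ρ, g R ≤ c * g' R) : segAvg g P Q ≤ c * segAvg g' P Q := by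
  have := intervalIntegral.integral_mono_on zero_le_one (hg.intervalIntegrable hα hP hQ)
    ((hg'.intervalIntegrable hα hP hQ).const_mul c)
    fun s hs => hc _ (lineMap_mem_slab hP hQ hs)
  simpa [segAvg] using this

theorem abs_segAvg_le (hg : Tame ρ B H α g) (hα : 0 < α) {P Q : ℝ × ℝ × ℝ}
    (hP : P ∈ slab ρ) (hQ : Q ∈ slab ρ) : |segAvg g P Q| ≤ B :=
  _root_.abs_le.2 ⟨hg.le_segAvg hα hP hQ fun R hR => (_root_.abs_le.1 (hg.abs_le R hR)).1,
    hg.segAvg_le hα hP hQ fun R hR => (_root_.abs_le.1 (hg.abs_le R hR)).2⟩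

theorem abs_segAvg_sub_le (hg : Tame ρ B H α g) (hα : 0 < α) (hH : 0 ≤ H)
    {P Q P' Q' : ℝ × ℝ × ℝ} (hP : P ∈ slab ρ) (hQ : Q ∈ slab ρ) (hP' : P' ∈ slab ρ)
    (hQ' : Q' ∈ slab ρ) {δ : ℝ} (h1 : dist P P' ≤ δ) (h2 : dist Q Q' ≤ δ) :
    |segAvg g P Q - segAvg g P' Q'| ≤ H * δ ^ α := by
  rw [segAvg, segAvg, ← intervalIntegral.integral_sub (hg.intervalIntegrable hα hP hQ)
    (hg.intervalIntegrable hα hP' hQ')]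
  have h := intervalIntegral.norm_integral_le_of_norm_le_const (a := (0 : ℝ)) (b := 1)
    (C := H * δ ^ α)
    (f := fun s => g (AffineMap.lineMap P Q s) - g (AffineMap.lineMap P' Q' s)) ?_
  · simpa using h
  · intro s hs
    rw [uIoc_of_le zero_le_one] at hs
    have hs' : s ∈ Icc (0 : ℝ) 1 := ⟨hs.1.le, hs.2⟩
    refine (hg.holder _ (lineMap_mem_slab hP hQ hs') _ (lineMap_mem_slab hP' hQ' hs')).trans ?_
    have := dist_lineMap_le h1 h2 hs'
    gcongr

end Tame

variable {S : TriMap}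

/-- The increment of the lift between two points of a slab: the mean value formula with the
averaged entries of the differential. -/
theorem IsSolenoid.lift_sub (hS : S.IsSolenoid) (b : Bounds S) {P Q : ℝ × ℝ × ℝ}
    (hP : P ∈ slab b.ρ) (hQ : Q ∈ slab b.ρ) :
    S.η Q.1 - S.η P.1 = segAvg S.dxx P Q * (Q.1 - P.1) ∧
    (S.lift Q).2.1 - (S.lift P).2.1 =
      segAvg S.dyx P Q * (Q.1 - P.1) + segAvg S.dyy P Q * (Q.2.1 - P.2.1) ∧
    (S.lift Q).2.2 - (S.lift P).2.2 =
      segAvg S.dzx P Q * (Q.1 - P.1) + segAvg S.dzy P Q * (Q.2.1 - P.2.1) +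
        segAvg S.dzz P Q * (Q.2.2 - P.2.2) := by
  have hcov : ∀ s ∈ uIcc (0 : ℝ) 1, (AffineMap.lineMap P Q s : ℝ × ℝ × ℝ) ∈ cover := by
    intro s hs
    rw [uIcc_of_le zero_le_one] at hs
    exact slab_subset_cover b.ρ_nonneg b.ρ_lt (lineMap_mem_slab hP hQ hs)
  have hd : ∀ s ∈ uIcc (0 : ℝ) 1, _ := fun s hs =>
    hS.hasDerivAt_lift_curve (AffineMap.hasDerivAt_lineMap (a := P) (b := Q) (x := s)) (hcov s hs)
  have hi : ∀ {g : ℝ × ℝ × ℝ → ℝ}, Tame b.ρ b.B b.H b.α g → ∀ c : ℝ, IntervalIntegrable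
      (fun s : ℝ => g (AffineMap.lineMap P Q s) * c) MeasureTheory.volume 0 1 :=
    fun hg c => (hg.intervalIntegrable b.α_pos hP hQ).mul_const c
  have hv : ∀ s ∈ uIcc (0 : ℝ) 1, _ := fun s hs => hS.fderiv_lift_apply (hcov s hs) (Q - P)
  refine ⟨?_, ?_, ?_⟩
  · have := intervalIntegral.integral_eq_sub_of_hasDerivAt
      (f := fun s => S.η (AffineMap.lineMap P Q s : ℝ × ℝ × ℝ).1)
      (f' := fun s => S.dxx (AffineMap.lineMap P Q s) * (Q - P).1)
      (fun s hs => by have := (hd s hs).1; rwa [hv s hs] at this) (hi b.xx _)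
    simp only [AffineMap.lineMap_apply_one, AffineMap.lineMap_apply_zero,
      intervalIntegral.integral_mul_const] at this
    rw [← this]; rfl
  · have := intervalIntegral.integral_eq_sub_of_hasDerivAt
      (f := fun s => (S.lift (AffineMap.lineMap P Q s : ℝ × ℝ × ℝ)).2.1)
      (f' := fun s => S.dyx (AffineMap.lineMap P Q s) * (Q - P).1 +
        S.dyy (AffineMap.lineMap P Q s) * (Q - P).2.1)
      (fun s hs => by have := (hd s hs).2.1; rwa [hv s hs] at this)
      ((hi b.yx _).add (hi b.yy _))
    rw [intervalIntegral.integral_add (hi b.yx _) (hi b.yy _)] at this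
    simp only [AffineMap.lineMap_apply_one, AffineMap.lineMap_apply_zero,
      intervalIntegral.integral_mul_const] at this
    rw [← this]; rfl
  · have := intervalIntegral.integral_eq_sub_of_hasDerivAt
      (f := fun s => (S.lift (AffineMap.lineMap P Q s : ℝ × ℝ × ℝ)).2.2)
      (f' := fun s => S.dzx (AffineMap.lineMap P Q s) * (Q - P).1 +
        S.dzy (AffineMap.lineMap P Q s) * (Q - P).2.1 +
        S.dzz (AffineMap.lineMap P Q s) * (Q - P).2.2)
      (fun s hs => by have := (hd s hs).2.2; rwa [hv s hs] at this)
      (((hi b.zx _).add (hi b.zy _)).add (hi b.zz _))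
    rw [intervalIntegral.integral_add ((hi b.zx _).add (hi b.zy _)) (hi b.zz _),
      intervalIntegral.integral_add (hi b.zx _) (hi b.zy _)] at this
    simp only [AffineMap.lineMap_apply_one, AffineMap.lineMap_apply_zero,
      intervalIntegral.integral_mul_const] at this
    rw [← this]; rfl

/-- A bounded sequence with `e k ≤ q e (k + 1) + c` and `q < 1` satisfies `e 0 ≤ c / (1 - q)`. -/
theorem le_div_of_forall_le_mul_succ {e : ℕ → ℝ} {q c E : ℝ} (hq0 : 0 ≤ q) (hq1 : q < 1)
    (hE : ∀ k, e k ≤ E) (h : ∀ k, e k ≤ q * e (k + 1) + c) : e 0 ≤ c / (1 - q) := by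
  have h1 : 0 < 1 - q := by linarith
  have key : ∀ n, e 0 - c / (1 - q) ≤ q ^ n * (e n - c / (1 - q)) := by
    intro n
    induction n with
    | zero => simp
    | succ n ih =>
      refine ih.trans ?_
      rw [pow_succ, mul_assoc]
      have : c / (1 - q) = q * (c / (1 - q)) + c := by field_simp; ring
      have h2 := h n
      gcongr
      linarith
  have hlim : Tendsto (fun n : ℕ => q ^ n * (E - c / (1 - q))) atTop (𝓝 0) := by
    simpa using (tendsto_pow_atTop_nhds_zero_of_lt_one hq0 hq1).mul_const (E - c / (1 - q))
  have : e 0 - c / (1 - q) ≤ 0 := ge_of_tendsto' hlim fun n => (key n).trans (by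
    have := hE n
    gcongr)
  linarith

namespace Bounds

variable (b : Bounds S)

theorem zero_mem_slab (x : ℝ) : (x, (0 : ℝ), (0 : ℝ)) ∈ slab b.ρ := by
  simp [slab, sq_nonneg]

theorem B_pos : 0 < b.B :=
  b.a₀_pos.trans_le ((b.le_dyy _ (b.zero_mem_slab 0)).trans
    ((le_abs_self _).trans (b.yy.abs_le _ (b.zero_mem_slab 0))))

theorem ℓ_pos : 0 < b.ℓ :=
  b.a₀_pos.trans_le ((b.le_dyy _ (b.zero_mem_slab 0)).trans (b.dyy_le _ (b.zero_mem_slab 0)))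

theorem μ_pos : 0 < b.μ := one_pos.trans b.one_lt_μ

theorem dzz_le_ℓ {P : ℝ × ℝ × ℝ} (hP : P ∈ slab b.ρ) : S.dzz P ≤ b.ℓ := by
  refine (b.dzz_le P hP).trans ((mul_le_of_le_one_left ?_ b.κ_lt.le).trans (b.dyy_le P hP))
  exact b.a₀_pos.le.trans (b.le_dyy P hP)

/-- The weight of the `y`-coordinate in the adapted metric of the fibres. -/
def w : ℝ := 1 + 2 * b.B / (1 - b.ℓ)

/-- The contraction factor of `f` on fibres, for the adapted metric. -/
def q : ℝ := (1 + b.ℓ) / 2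

/-- The adapted metric `w |Δy| + |Δz|` of the fibres, for which `f` contracts fibres by `q`. -/
def gap (u v : ℝ × ℝ) : ℝ := b.w * |u.1 - v.1| + |u.2 - v.2|

theorem one_le_w : 1 ≤ b.w := by
  have := b.B_pos
  have := b.ℓ_lt
  have : 0 ≤ 2 * b.B / (1 - b.ℓ) := div_nonneg (by linarith) (by linarith)
  rw [w]; linarith

theorem q_nonneg : 0 ≤ b.q := by have := b.ℓ_pos; rw [q]; linarith
theorem q_lt : b.q < 1 := by have := b.ℓ_lt; rw [q]; linarith

theorem abs_fst_le_gap (u v : ℝ × ℝ) : |u.1 - v.1| ≤ b.gap u v := by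
  have := mul_le_mul_of_nonneg_right b.one_le_w (abs_nonneg (u.1 - v.1))
  rw [gap]
  linarith [abs_nonneg (u.2 - v.2)]

theorem abs_snd_le_gap (u v : ℝ × ℝ) : |u.2 - v.2| ≤ b.gap u v := by
  have := mul_nonneg (zero_le_one.trans b.one_le_w) (abs_nonneg (u.1 - v.1))
  rw [gap]
  linarith

theorem dist_le_gap (u v : ℝ × ℝ) : dist u v ≤ b.gap u v := by
  rw [Prod.dist_eq, Real.dist_eq, Real.dist_eq]
  exact max_le (b.abs_fst_le_gap u v) (b.abs_snd_le_gap u v)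

theorem eq_of_gap_le_zero {u v : ℝ × ℝ} (h : b.gap u v ≤ 0) : u = v :=
  dist_le_zero.1 ((b.dist_le_gap u v).trans h)

theorem abs_le_one_of_mem_slab {P : ℝ × ℝ × ℝ} (hP : P ∈ slab b.ρ) : |P.2.1| ≤ 1 ∧ |P.2.2| ≤ 1 := by
  have hP' : P.2.1 ^ 2 + P.2.2 ^ 2 < 1 := slab_subset_cover b.ρ_nonneg b.ρ_lt hP
  exact ⟨(sq_le_one_iff_abs_le_one _).1 (by nlinarith [sq_nonneg P.2.2]),
    (sq_le_one_iff_abs_le_one _).1 (by nlinarith [sq_nonneg P.2.1])⟩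

theorem gap_le_of_mem_slab {P Q : ℝ × ℝ × ℝ} (hP : P ∈ slab b.ρ) (hQ : Q ∈ slab b.ρ) :
    b.gap P.2 Q.2 ≤ 2 * b.w + 2 := by
  have h1 := b.abs_le_one_of_mem_slab hP
  have h2 := b.abs_le_one_of_mem_slab hQ
  have h3 : |P.2.1 - Q.2.1| ≤ 2 := (abs_sub _ _).trans (by linarith)
  have h4 : |P.2.2 - Q.2.2| ≤ 2 := (abs_sub _ _).trans (by linarith)
  have := b.one_le_w
  rw [gap]
  nlinarith

/-- One application of `f` contracts the fibre coordinates, up to the difference of the base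
points. -/
theorem gap_lift_le (hS : S.IsSolenoid) {P Q : ℝ × ℝ × ℝ} (hP : P ∈ slab b.ρ)
    (hQ : Q ∈ slab b.ρ) :
    b.gap (S.lift P).2 (S.lift Q).2 ≤ b.q * b.gap P.2 Q.2 + (b.w + 1) * b.B * |P.1 - Q.1| := by
  obtain ⟨-, hy, hz⟩ := hS.lift_sub b hQ hP
  have hα := b.α_pos
  have hyx := b.yx.abs_segAvg_le hα hQ hP
  have hzx := b.zx.abs_segAvg_le hα hQ hP
  have hzy := b.zy.abs_segAvg_le hα hQ hP
  have hyy : |segAvg S.dyy Q P| ≤ b.ℓ := abs_le.2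
    ⟨(neg_nonpos.2 b.ℓ_pos.le).trans (b.yy.le_segAvg hα hQ hP fun R hR =>
      b.a₀_pos.le.trans (b.le_dyy R hR)), b.yy.segAvg_le hα hQ hP b.dyy_le⟩
  have hzz : |segAvg S.dzz Q P| ≤ b.ℓ := abs_le.2
    ⟨(neg_nonpos.2 b.ℓ_pos.le).trans (b.zz.le_segAvg hα hQ hP fun R hR =>
      b.c₀_pos.le.trans (b.le_dzz R hR)), b.zz.segAvg_le hα hQ hP fun R hR => b.dzz_le_ℓ hR⟩
  have h1 : |(S.lift P).2.1 - (S.lift Q).2.1| ≤ b.B * |P.1 - Q.1| + b.ℓ * |P.2.1 - Q.2.1| := by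
    rw [hy]
    refine (abs_add_le _ _).trans ?_
    rw [abs_mul, abs_mul]
    gcongr
  have h2 : |(S.lift P).2.2 - (S.lift Q).2.2| ≤
      b.B * |P.1 - Q.1| + b.B * |P.2.1 - Q.2.1| + b.ℓ * |P.2.2 - Q.2.2| := by
    rw [hz]
    refine (abs_add_three _ _ _).trans ?_
    rw [abs_mul, abs_mul, abs_mul]
    gcongr
  have hw := b.one_le_w
  have hℓ := b.ℓ_lt
  have hwq : b.w * b.ℓ + b.B ≤ b.q * b.w := by
    have : b.q * b.w - b.w * b.ℓ = b.w * (1 - b.ℓ) / 2 := by rw [q]; ring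
    have h3 : b.w * (1 - b.ℓ) = (1 - b.ℓ) + 2 * b.B := by
      have : 1 - b.ℓ ≠ 0 := by linarith
      rw [w]; field_simp
    linarith
  have hq : b.ℓ ≤ b.q := by rw [q]; linarith
  have a1 := abs_nonneg (P.2.1 - Q.2.1)
  have a2 := abs_nonneg (P.2.2 - Q.2.2)
  have m1 := mul_le_mul_of_nonneg_left h1 (zero_le_one.trans hw)
  have m2 := mul_le_mul_of_nonneg_right hwq a1
  have m3 := mul_le_mul_of_nonneg_right hq a2
  simp only [gap]
  linarith

end Bounds

end TriMap

/-! ### The solenoid and backward orbits -/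

/-- The closed solid torus `y² + z² ≤ ρ²`. -/
def tube (ρ : ℝ) : Set Pt := {p | p.2.1 ^ 2 + p.2.2 ^ 2 ≤ ρ ^ 2}

theorem tube_subset_M {ρ : ℝ} (h0 : 0 ≤ ρ) (h1 : ρ < 1) : tube ρ ⊆ M := by
  intro p hp
  simp only [tube, M, mem_ofPred_eq] at *
  nlinarith

theorem isCompact_tube (ρ : ℝ) : IsCompact (tube ρ) := by
  have hbox : IsCompact ((univ : Set Circ) ×ˢ Icc (-|ρ|) |ρ| ×ˢ Icc (-|ρ|) |ρ|) :=
    isCompact_univ.prod (isCompact_Icc.prod isCompact_Icc)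
  refine hbox.of_isClosed_subset (isClosed_le (by fun_prop) continuous_const) ?_
  intro p hp
  have hp' : p.2.1 ^ 2 + p.2.2 ^ 2 ≤ ρ ^ 2 := hp
  refine ⟨trivial, ?_, ?_⟩
  · exact abs_le.1 (sq_le_sq.1 (by nlinarith [sq_nonneg p.2.2]))
  · exact abs_le.1 (sq_le_sq.1 (by nlinarith [sq_nonneg p.2.1]))

/-- A function on `S¹ × ℝ × ℝ` is continuous on `M` if its lift is continuous on the universal
cover of `M`. -/
theorem continuousOn_of_lift {X : Type*} [TopologicalSpace X] {F : Pt → X} {g : ℝ × ℝ × ℝ → X}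
    (h : ∀ P : ℝ × ℝ × ℝ, F ((P.1 : Circ), P.2) = g P) (hg : ContinuousOn g cover) :
    ContinuousOn F M := by
  intro p hp
  apply ContinuousAt.continuousWithinAt
  obtain ⟨x, hx⟩ := QuotientAddGroup.mk_surjective p.1
  have hq : IsOpenQuotientMap (Prod.map (fun x : ℝ => (x : Circ)) (id : ℝ × ℝ → ℝ × ℝ)) :=
    IsOpenQuotientMap.prodMap QuotientAddGroup.isOpenQuotientMap_mk IsOpenQuotientMap.id
  have hp' : p = Prod.map (fun x : ℝ => (x : Circ)) (id : ℝ × ℝ → ℝ × ℝ) (x, p.2) :=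
    Prod.ext hx.symm rfl
  have hcov : (x, p.2) ∈ cover := hp
  have h1 : F ∘ Prod.map (fun x : ℝ => (x : Circ)) (id : ℝ × ℝ → ℝ × ℝ) = g := funext h
  have h2 : F (Prod.map (fun x : ℝ => (x : Circ)) (id : ℝ × ℝ → ℝ × ℝ) (x, p.2)) = g (x, p.2) :=
    h (x, p.2)
  rw [ContinuousAt, hp', ← hq.map_nhds_eq, tendsto_map'_iff, h1, h2]
  exact hg.continuousAt (isOpen_cover.mem_nhds hcov)

theorem exists_coe_eq_abs_sub_eq_dist (a : ℝ) (x : Circ) :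
    ∃ a' : ℝ, (a' : Circ) = x ∧ |a - a'| = dist (a : Circ) x := by
  obtain ⟨a', rfl⟩ := QuotientAddGroup.mk_surjective x
  refine ⟨a' + round ((2 * π)⁻¹ * (a - a')) * (2 * π), ?_, ?_⟩
  · have : ((round ((2 * π)⁻¹ * (a - a')) * (2 * π) : ℝ) : Circ) = 0 :=
      (AddCircle.coe_eq_zero_iff _).2 ⟨_, zsmul_eq_mul _ _⟩
    rw [AddCircle.coe_add, this, add_zero]
  · rw [dist_eq_norm, ← AddCircle.coe_sub, AddCircle.norm_eq]
    congr 1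
    ring

theorem coe_eq_coe_iff {a a' : ℝ} : (a : Circ) = (a' : Circ) ↔ ∃ n : ℤ, a = a' + 2 * π * n := by
  rw [← sub_eq_zero, ← AddCircle.coe_sub, AddCircle.coe_eq_zero_iff]
  refine exists_congr fun n => ?_
  rw [zsmul_eq_mul]
  constructor <;> intro h <;> linarith

theorem rep_mem (x : Circ) : rep x ∈ Ico 0 (2 * π) := by
  have := (AddCircle.equivIco (2 * π) 0 x).2
  exact ⟨this.1, this.2.trans_eq (zero_add _)⟩

theorem rep_coe_of_mem {a : ℝ} (ha : a ∈ Ico 0 (2 * π)) : rep (a : Circ) = a := by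
  obtain ⟨n, hn⟩ := coe_eq_coe_iff.1 (coe_rep (a : Circ))
  have h := rep_mem (a : Circ)
  have hpi := Real.two_pi_pos
  have h1 : (n : ℝ) < 1 := by by_contra! hc; nlinarith [h.2, ha.1]
  have h2 : (-1 : ℝ) < n := by by_contra! hc; nlinarith [h.1, ha.2]
  have : n = 0 := by
    have h1' : n < 1 := by exact_mod_cast h1
    have h2' : -1 < n := by exact_mod_cast h2
    omega
  rw [hn, this]; simp

namespace TriMap

variable {S : TriMap}

/-- The map that `f` induces on the circle. -/
def circ (S : TriMap) (x : Circ) : Circ := (S.η (rep x) : Circ)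

theorem circ_coe (S : TriMap) (x : ℝ) : S.circ (x : Circ) = (S.η x : Circ) :=
  periodic_rep S.coe_η_periodic x

theorem f_fst (S : TriMap) (p : Pt) : (S.f p).1 = S.circ p.1 := rfl

theorem f_snd (S : TriMap) {p : Pt} {x : ℝ} (h : p.1 = (x : Circ)) :
    (S.f p).2 = (S.lift (x, p.2)).2 := by
  have := S.f_coe x p.2.1 p.2.2
  rw [← h] at this
  exact congrArg Prod.snd this

theorem back_succ (S : TriMap) (n : ℕ) (p : Pt) :
    S.back (n + 1) p = Function.invFunOn S.f M (S.back n p) :=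
  Function.iterate_succ_apply' _ _ _

theorem back_add (S : TriMap) (m n : ℕ) (p : Pt) : S.back (m + n) p = S.back m (S.back n p) :=
  Function.iterate_add_apply _ _ _ _

namespace IsSolenoid

theorem mapsTo (hS : S.IsSolenoid) : MapsTo S.f M M := fun _ hp =>
  hS.attractor (subset_closure (mem_image_of_mem _ hp))

theorem invFunOn_f (hS : S.IsSolenoid) {p : Pt} (hp : p ∈ M) :
    Function.invFunOn S.f M (S.f p) = p :=
  hS.injOn.leftInvOn_invFunOn hp

theorem back_succ_f (hS : S.IsSolenoid) (n : ℕ) {p : Pt} (hp : p ∈ M) :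
    S.back (n + 1) (S.f p) = S.back n p := by
  rw [back, Function.iterate_succ_apply, hS.invFunOn_f hp]; rfl

theorem back_iterate (hS : S.IsSolenoid) (k j : ℕ) {p : Pt} (hp : p ∈ M) :
    S.back k (S.f^[k + j] p) = S.f^[j] p := by
  induction k with
  | zero => simp [back]
  | succ k ih =>
    rw [Nat.succ_add, Function.iterate_succ_apply',
      hS.back_succ_f k (hS.mapsTo.iterate _ hp), ih]

theorem Lam_subset_M (_ : S.IsSolenoid) : S.Lam ⊆ M := by
  intro p hp
  simpa using mem_iInter.1 hp 0

theorem f_mem_Lam (hS : S.IsSolenoid) {p : Pt} (hp : p ∈ S.Lam) : S.f p ∈ S.Lam := by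
  refine mem_iInter.2 fun n => ?_
  obtain ⟨w, hw, rfl⟩ := mem_iInter.1 hp n
  exact ⟨S.f w, hS.mapsTo hw, by rw [← Function.iterate_succ_apply, Function.iterate_succ_apply']⟩

theorem exists_back (hS : S.IsSolenoid) {p : Pt} (hp : p ∈ S.Lam) :
    ∃ q ∈ S.Lam, S.f q = p := by
  obtain ⟨q, hq, hqp⟩ := mem_iInter.1 hp 1
  refine ⟨q, mem_iInter.2 fun n => ?_, hqp⟩
  obtain ⟨w, hw, hwp⟩ := mem_iInter.1 hp (n + 1)
  rw [Function.iterate_succ_apply'] at hwp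
  have := hS.injOn (hS.mapsTo.iterate n hw) hq (hwp.trans hqp.symm)
  exact ⟨w, hw, this⟩

theorem back_mem (hS : S.IsSolenoid) (n : ℕ) {p : Pt} (hp : p ∈ S.Lam) : S.back n p ∈ S.Lam := by
  induction n with
  | zero => exact hp
  | succ n ih =>
    obtain ⟨q, hq, h⟩ := hS.exists_back ih
    rw [back_succ, ← h, hS.invFunOn_f (hS.Lam_subset_M hq)]
    exact hq

theorem f_back (hS : S.IsSolenoid) (n : ℕ) {p : Pt} (hp : p ∈ S.Lam) :
    S.f (S.back (n + 1) p) = S.back n p := by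
  obtain ⟨q, hq, h⟩ := hS.exists_back (hS.back_mem n hp)
  rw [back_succ, ← h, hS.invFunOn_f (hS.Lam_subset_M hq)]

theorem iterate_f_back (hS : S.IsSolenoid) (k n : ℕ) {p : Pt} (hp : p ∈ S.Lam) :
    S.f^[k] (S.back (n + k) p) = S.back n p := by
  induction k with
  | zero => rfl
  | succ k ih => rw [Function.iterate_succ_apply, ← add_assoc, hS.f_back _ hp, ih]

theorem continuousOn_f (hS : S.IsSolenoid) : ContinuousOn S.f M := by
  refine continuousOn_of_lift (g := fun P => (((S.lift P).1 : Circ), (S.lift P).2))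
    (fun P => S.f_coe P.1 P.2.1 P.2.2) ?_
  have h : ContinuousOn S.lift cover := fun P hP =>
    (hS.differentiable P hP).continuousAt.continuousWithinAt
  exact ((AddCircle.continuous_mk' _).comp_continuousOn h.fst).prodMk h.snd

theorem continuousOn_iterate (hS : S.IsSolenoid) (n : ℕ) : ContinuousOn S.f^[n] M :=
  hS.continuousOn_f.iterate hS.mapsTo n

end IsSolenoid

namespace Bounds

theorem tube_subset_M (b : Bounds S) : tube b.ρ ⊆ M := Solenoid.tube_subset_M b.ρ_nonneg b.ρ_lt

theorem f_mem_tube (b : Bounds S) {p : Pt} (hp : p ∈ M) : S.f p ∈ tube b.ρ := b.maps p hp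

theorem Lam_subset_tube (b : Bounds S) : S.Lam ⊆ tube b.ρ := by
  intro p hp
  obtain ⟨q, hq, rfl⟩ := mem_iInter.1 hp 1
  exact b.f_mem_tube hq

theorem isCompact_Lam (b : Bounds S) (hS : S.IsSolenoid) : IsCompact S.Lam := by
  have h : S.Lam = ⋂ n : ℕ, S.f^[n] '' tube b.ρ := by
    apply Subset.antisymm
    · intro p hp
      refine mem_iInter.2 fun n => ?_
      obtain ⟨w, hw, rfl⟩ := mem_iInter.1 hp (n + 1)
      exact ⟨S.f w, b.f_mem_tube hw, rfl⟩
    · exact iInter_mono fun n => image_mono b.tube_subset_M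
  have hc : ∀ n : ℕ, IsCompact (S.f^[n] '' tube b.ρ) := fun n =>
    (isCompact_tube b.ρ).image_of_continuousOn ((hS.continuousOn_iterate n).mono b.tube_subset_M)
  rw [h]
  exact (hc 0).of_isClosed_subset (isClosed_iInter fun n => (hc n).isClosed) (iInter_subset _ 0)

theorem continuousOn_back_one (b : Bounds S) (hS : S.IsSolenoid) :
    ContinuousOn (S.back 1) S.Lam := by
  have hK : CompactSpace S.Lam := isCompact_iff_compactSpace.1 (b.isCompact_Lam hS)
  let e : S.Lam ≃ S.Lam :=
    { toFun := fun p => ⟨S.f p, hS.f_mem_Lam p.2⟩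
      invFun := fun p => ⟨S.back 1 p, hS.back_mem 1 p.2⟩
      left_inv := fun p => Subtype.ext (hS.back_succ_f 0 (hS.Lam_subset_M p.2))
      right_inv := fun p => Subtype.ext (hS.f_back 0 p.2) }
  have he : Continuous e :=
    ((hS.continuousOn_f.mono hS.Lam_subset_M).domRestrict).subtype_mk _
  have h := (he.homeoOfEquivCompactToT2).symm.continuous
  rw [continuousOn_iff_continuous_domRestrict]
  exact continuous_subtype_val.comp h

theorem continuousOn_back (b : Bounds S) (hS : S.IsSolenoid) (n : ℕ) :
    ContinuousOn (S.back n) S.Lam := by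
  induction n with
  | zero => exact continuousOn_id
  | succ n ih =>
    have : S.back (n + 1) = S.back 1 ∘ S.back n := by
      funext p; rw [Function.comp, ← back_add, add_comm]
    rw [this]
    exact (b.continuousOn_back_one hS).comp ih fun p hp => hS.back_mem n hp

/-! ### The inverse of `η` -/

theorem η_sub (b : Bounds S) (hS : S.IsSolenoid) (x y : ℝ) :
    S.η x - S.η y = segAvg S.dxx (y, 0, 0) (x, 0, 0) * (x - y) :=
  (hS.lift_sub b (b.zero_mem_slab y) (b.zero_mem_slab x)).1

theorem μ_mul_le (b : Bounds S) (hS : S.IsSolenoid) (x y : ℝ) :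
    b.μ * |x - y| ≤ |S.η x - S.η y| := by
  have h := b.xx.le_segAvg b.α_pos (b.zero_mem_slab y) (b.zero_mem_slab x) b.le_dxx
  rw [b.η_sub hS, abs_mul]
  gcongr
  exact h.trans (le_abs_self _)

theorem abs_η_sub_le (b : Bounds S) (hS : S.IsSolenoid) (x y : ℝ) :
    |S.η x - S.η y| ≤ b.B * |x - y| := by
  have h := b.xx.abs_segAvg_le b.α_pos (b.zero_mem_slab y) (b.zero_mem_slab x)
  rw [b.η_sub hS, abs_mul]
  gcongr

/-- Two different points with the same image under the circle map are not too close. -/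
theorem exists_separation (b : Bounds S) (hS : S.IsSolenoid) :
    ∃ δ > 0, ∀ x x' : Circ, S.circ x = S.circ x' → dist x x' < δ → x = x' := by
  refine ⟨2 * π / b.B, div_pos Real.two_pi_pos b.B_pos, fun x x' h hd => ?_⟩
  obtain ⟨a, rfl⟩ := QuotientAddGroup.mk_surjective x
  obtain ⟨a', rfl, ha'⟩ := exists_coe_eq_abs_sub_eq_dist a x'
  have h' : ((S.η a : ℝ) : Circ) = (S.η a' : ℝ) := by
    rw [← circ_coe, ← circ_coe]; exact h
  obtain ⟨n, hn⟩ := coe_eq_coe_iff.1 h'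
  have hlt : |S.η a - S.η a'| < 2 * π := by
    refine (b.abs_η_sub_le hS a a').trans_lt ?_
    have : |a - a'| < 2 * π / b.B := by rw [ha']; exact hd
    rw [lt_div_iff₀ b.B_pos] at this
    linarith
  have hn0 : n = 0 := by
    rw [hn, add_sub_cancel_left, abs_mul, abs_of_pos Real.two_pi_pos] at hlt
    have : |(n : ℝ)| < 1 := by
      by_contra! hc
      nlinarith [Real.two_pi_pos]
    rw [← Int.cast_abs] at this
    exact Int.abs_lt_one_iff.1 (by exact_mod_cast this)
  have : S.η a - S.η a' = 0 := by rw [hn, hn0]; simp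
  have h2 := b.μ_mul_le hS a a'
  rw [this, abs_zero] at h2
  have h3 : |a - a'| ≤ 0 := by
    by_contra! hc
    have := mul_pos b.μ_pos hc
    linarith
  rw [abs_nonpos_iff, sub_eq_zero] at h3
  change (a : Circ) = (a' : Circ)
  rw [h3]

end Bounds

/-- The inverse of the lift of `η`. -/
def psi (S : TriMap) : ℝ → ℝ := Function.invFun S.η

namespace IsSolenoid

theorem strictMono_η (hS : S.IsSolenoid) : StrictMono S.η :=
  strictMono_of_deriv_pos fun x => one_pos.trans (hS.one_lt_eta x)

theorem surjective_η (hS : S.IsSolenoid) : Function.Surjective S.η := by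
  have hc : Continuous S.η :=
    continuous_iff_continuousAt.2 fun x => (hS.hasDerivAt_η x).continuousAt
  have hmono : Monotone fun x => S.η x - x := by
    refine monotone_of_deriv_nonneg (fun x => ?_) fun x => ?_
    · exact (hS.hasDerivAt_η x).differentiableAt.sub differentiableAt_id
    · have h : deriv (fun x => S.η x - x) x = deriv S.η x - 1 :=
        ((hS.hasDerivAt_η x).sub (hasDerivAt_id x)).deriv
      rw [h]
      linarith [hS.one_lt_eta x]
  refine hc.surjective ?_ ?_
  · refine tendsto_atTop_mono' _ ?_ tendsto_id
    filter_upwards [eventually_ge_atTop 0] with x hx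
    have := hmono hx
    simp only [S.η_zero] at this
    simp only [id]; linarith
  · refine tendsto_atBot_mono' _ ?_ tendsto_id
    filter_upwards [eventually_le_atBot 0] with x hx
    have := hmono hx
    simp only [S.η_zero] at this
    simp only [id]; linarith

theorem η_psi (hS : S.IsSolenoid) (x : ℝ) : S.η (S.psi x) = x :=
  Function.rightInverse_invFun hS.surjective_η x

theorem psi_η (hS : S.IsSolenoid) (x : ℝ) : S.psi (S.η x) = x :=
  Function.leftInverse_invFun hS.strictMono_η.injective x

theorem strictMono_psi (hS : S.IsSolenoid) : StrictMono S.psi := fun x y h => by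
  rwa [← hS.strictMono_η.lt_iff_lt, hS.η_psi, hS.η_psi]

end IsSolenoid

theorem η_two_pi (S : TriMap) : S.η (2 * π) = S.d * (2 * π) := by
  have := S.η_add 0
  rwa [zero_add, S.η_zero, zero_add] at this

theorem Bounds.abs_psi_sub_le (b : Bounds S) (hS : S.IsSolenoid) (x y : ℝ) :
    |S.psi x - S.psi y| ≤ b.μ⁻¹ * |x - y| := by
  have := b.μ_mul_le hS (S.psi x) (S.psi y)
  rw [hS.η_psi, hS.η_psi] at this
  rwa [inv_mul_eq_div, le_div_iff₀' b.μ_pos]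

/-! ### Unstable lines and their codes -/

/-- The `k`-th preimage of `τ` under the lift of `η`, along the inverse branches given by the
code `m`. -/
def G (S : TriMap) (m : ℕ → Fin S.d) : ℕ → ℝ → ℝ
  | 0, τ => τ
  | k + 1, τ => S.psi (G S m k τ + 2 * π * (m k : ℕ))

/-- The point of the solenoid over `τ` whose backward orbit has the first coordinates `G m k τ`. -/
def line (S : TriMap) (m : ℕ → Fin S.d) (τ : ℝ) : Pt :=
  Classical.epsilon fun p => p ∈ S.Lam ∧ ∀ k, (S.back k p).1 = (S.G m k τ : Circ)

/-- The code without its first `n` symbols. -/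
def shift (n : ℕ) {d : ℕ} (m : ℕ → Fin d) : ℕ → Fin d := fun j => m (n + j)

theorem G_zero (m : ℕ → Fin S.d) (τ : ℝ) : S.G m 0 τ = τ := rfl

theorem G_add (m : ℕ → Fin S.d) (n k : ℕ) (τ : ℝ) :
    S.G m (n + k) τ = S.G (shift n m) k (S.G m n τ) := by
  induction k with
  | zero => rfl
  | succ k ih =>
    change S.psi (S.G m (n + k) τ + _) = S.psi (S.G (shift n m) k (S.G m n τ) + _)
    rw [ih]; rfl

theorem G_congr {m m' : ℕ → Fin S.d} {n : ℕ} (h : ∀ j < n, m j = m' j) (τ : ℝ) :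
    S.G m n τ = S.G m' n τ := by
  induction n with
  | zero => rfl
  | succ n ih =>
    rw [G, G, ih fun j hj => h j (by omega), h n (by omega)]

theorem circ_G (hS : S.IsSolenoid) (m : ℕ → Fin S.d) (k : ℕ) (τ : ℝ) :
    S.circ (S.G m (k + 1) τ : Circ) = (S.G m k τ : Circ) := by
  rw [circ_coe, G, hS.η_psi]
  exact coe_eq_coe_iff.2 ⟨(m k : ℕ), by simp⟩

theorem η_G (hS : S.IsSolenoid) (m : ℕ → Fin S.d) (k : ℕ) (τ : ℝ) :
    S.η (S.G m (k + 1) τ) = S.G m k τ + 2 * π * (m k : ℕ) := by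
  rw [G, hS.η_psi]

theorem psi_zero (hS : S.IsSolenoid) : S.psi 0 = 0 := by
  have := hS.psi_η 0
  rwa [S.η_zero] at this

theorem psi_two_pi (hS : S.IsSolenoid) : S.psi (S.d * (2 * π)) = 2 * π := by
  have := hS.psi_η (2 * π)
  rwa [S.η_two_pi] at this

theorem strictMono_G (hS : S.IsSolenoid) (m : ℕ → Fin S.d) (k : ℕ) : StrictMono (S.G m k) := by
  induction k with
  | zero => exact strictMono_id
  | succ k ih =>
    intro a b hab
    exact hS.strictMono_psi (add_lt_add_left (ih hab) _)

theorem G_zero_two_pi (hS : S.IsSolenoid) (m : ℕ → Fin S.d) (k : ℕ) :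
    0 ≤ S.G m k 0 ∧ S.G m k (2 * π) ≤ 2 * π := by
  have hpi := Real.two_pi_pos
  induction k with
  | zero => exact ⟨le_rfl, le_rfl⟩
  | succ k ih =>
    constructor
    · refine (psi_zero hS).symm.le.trans (hS.strictMono_psi.monotone ?_)
      have : 0 ≤ 2 * π * (m k : ℕ) := by positivity
      linarith [ih.1]
    · refine le_trans (hS.strictMono_psi.monotone ?_) (psi_two_pi hS).le
      have : ((m k : ℕ) : ℝ) + 1 ≤ S.d := by exact_mod_cast (m k).2
      nlinarith [ih.2]

theorem G_mem_Ico (hS : S.IsSolenoid) (m : ℕ → Fin S.d) (k : ℕ) {τ : ℝ}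
    (hτ : τ ∈ Ico 0 (2 * π)) : S.G m k τ ∈ Ico 0 (2 * π) :=
  ⟨(G_zero_two_pi hS m k).1.trans ((strictMono_G hS m k).monotone hτ.1),
    (strictMono_G hS m k hτ.2).trans_le (G_zero_two_pi hS m k).2⟩

theorem G_mem_Icc (hS : S.IsSolenoid) (m : ℕ → Fin S.d) (k : ℕ) {τ : ℝ}
    (hτ : τ ∈ Icc 0 (2 * π)) : S.G m k τ ∈ Icc 0 (2 * π) :=
  ⟨(G_zero_two_pi hS m k).1.trans ((strictMono_G hS m k).monotone hτ.1),
    ((strictMono_G hS m k).monotone hτ.2).trans (G_zero_two_pi hS m k).2⟩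

namespace Bounds

theorem abs_G_sub_le (b : Bounds S) (hS : S.IsSolenoid) (m : ℕ → Fin S.d) (k : ℕ) (τ τ' : ℝ) :
    |S.G m k τ - S.G m k τ'| ≤ b.μ⁻¹ ^ k * |τ - τ'| := by
  induction k with
  | zero => simp [G_zero]
  | succ k ih =>
    refine (b.abs_psi_sub_le hS _ _).trans ?_
    rw [add_sub_add_right_eq_sub, pow_succ', mul_assoc]
    have := b.μ_pos
    gcongr

theorem μ_inv_pos (b : Bounds S) : 0 < b.μ⁻¹ := inv_pos.2 b.μ_pos

theorem μ_inv_lt (b : Bounds S) : b.μ⁻¹ < 1 := inv_lt_one_of_one_lt₀ b.one_lt_μ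

theorem abs_G_sub_le' (b : Bounds S) (hS : S.IsSolenoid) (m : ℕ → Fin S.d) (k : ℕ) (τ τ' : ℝ) :
    |S.G m k τ - S.G m k τ'| ≤ |τ - τ'| := by
  refine (b.abs_G_sub_le hS m k τ τ').trans (mul_le_of_le_one_left (abs_nonneg _) ?_)
  exact pow_le_one₀ b.μ_inv_pos.le b.μ_inv_lt.le

theorem continuous_G (b : Bounds S) (hS : S.IsSolenoid) (m : ℕ → Fin S.d) (k : ℕ) :
    Continuous (S.G m k) :=
  (LipschitzWith.of_dist_le_mul (K := 1) fun x y => by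
    simpa [Real.dist_eq] using b.abs_G_sub_le' hS m k x y).continuous

/-- A Lipschitz constant of the fibre coordinates along unstable lines. -/
def T (b : Bounds S) : ℝ := (b.w + 1) * b.B / (1 - b.q)

theorem T_nonneg (b : Bounds S) : 0 ≤ b.T := by
  have h1 := b.one_le_w
  have h2 := b.B_pos
  have h3 := b.q_lt
  exact div_nonneg (by positivity) (by linarith)

/-- Two points of the solenoid whose backward orbits stay close in the base are close: the
distance of the fibre coordinates satisfies a contracting recursion along backward orbits. -/
theorem gap_le_of_back (b : Bounds S) (hS : S.IsSolenoid) {p p' : Pt} (hp : p ∈ S.Lam)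
    (hp' : p' ∈ S.Lam) {t t' : ℕ → ℝ} {δ : ℝ} (ht : ∀ k, (S.back k p).1 = (t k : Circ))
    (ht' : ∀ k, (S.back k p').1 = (t' k : Circ)) (hδ : ∀ k, |t k - t' k| ≤ δ) :
    b.gap p.2 p'.2 ≤ b.T * δ := by
  have hmem : ∀ k, (t k, (S.back k p).2) ∈ slab b.ρ := fun k =>
    b.Lam_subset_tube (hS.back_mem k hp)
  have hmem' : ∀ k, (t' k, (S.back k p').2) ∈ slab b.ρ := fun k =>
    b.Lam_subset_tube (hS.back_mem k hp')
  have h := le_div_of_forall_le_mul_succ (e := fun k => b.gap (S.back k p).2 (S.back k p').2)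
    (c := (b.w + 1) * b.B * δ) b.q_nonneg b.q_lt
    (fun k => b.gap_le_of_mem_slab (hmem k) (hmem' k)) ?_
  · calc b.gap p.2 p'.2 ≤ _ := h
      _ = b.T * δ := by rw [T]; ring
  · intro k
    have h1 := b.gap_lift_le hS (hmem (k + 1)) (hmem' (k + 1))
    rw [← f_snd S (ht (k + 1)), ← f_snd S (ht' (k + 1)), hS.f_back k hp, hS.f_back k hp'] at h1
    refine h1.trans ?_
    have := b.one_le_w
    have := b.B_pos
    have := hδ (k + 1)
    gcongr

/-- The nested compact sets `fⁿ` of discs over the preimages of `τ` have a common point. -/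
theorem line_spec (b : Bounds S) (hS : S.IsSolenoid) (m : ℕ → Fin S.d) (τ : ℝ) :
    S.line m τ ∈ S.Lam ∧ ∀ k, (S.back k (S.line m τ)).1 = (S.G m k τ : Circ) := by
  refine Classical.epsilon_spec (p := fun p => p ∈ S.Lam ∧ ∀ k, (S.back k p).1 = (S.G m k τ : Circ))
    ?_
  let K : ℕ → Set Pt := fun n => S.f^[n] '' (tube b.ρ ∩ {p | p.1 = (S.G m n τ : Circ)})
  have hc : ∀ n, IsCompact (K n) := fun n =>
    ((isCompact_tube b.ρ).inter_right (isClosed_eq continuous_fst continuous_const)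
      ).image_of_continuousOn
      ((hS.continuousOn_iterate n).mono (inter_subset_left.trans b.tube_subset_M))
  have hsub : ∀ n, K (n + 1) ⊆ K n := by
    rintro n _ ⟨w, hw, rfl⟩
    refine ⟨S.f w, ⟨b.f_mem_tube (b.tube_subset_M hw.1), ?_⟩, rfl⟩
    have h1 : w.1 = (S.G m (n + 1) τ : Circ) := hw.2
    change (S.f w).1 = _
    rw [f_fst, h1, circ_G hS]
  have hne : ∀ n, (K n).Nonempty := fun n =>
    ⟨_, mem_image_of_mem _ (show ((S.G m n τ : Circ), ((0 : ℝ), (0 : ℝ))) ∈ _ from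
      ⟨b.zero_mem_slab 0, rfl⟩)⟩
  obtain ⟨p, hp⟩ := IsCompact.nonempty_iInter_of_sequence_nonempty_isCompact_isClosed K hsub hne
    (hc 0) fun n => (hc n).isClosed
  refine ⟨p, mem_iInter.2 fun n => ?_, fun k => ?_⟩
  · obtain ⟨w, hw, rfl⟩ := mem_iInter.1 hp n
    exact ⟨w, b.tube_subset_M hw.1, rfl⟩
  · obtain ⟨w, hw, rfl⟩ := mem_iInter.1 hp k
    have h := hS.back_iterate k 0 (b.tube_subset_M hw.1)
    rw [add_zero] at h
    rw [h]
    exact hw.2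

theorem line_mem (b : Bounds S) (hS : S.IsSolenoid) (m : ℕ → Fin S.d) (τ : ℝ) :
    S.line m τ ∈ S.Lam := (b.line_spec hS m τ).1

theorem back_line_fst (b : Bounds S) (hS : S.IsSolenoid) (m : ℕ → Fin S.d) (k : ℕ) (τ : ℝ) :
    (S.back k (S.line m τ)).1 = (S.G m k τ : Circ) := (b.line_spec hS m τ).2 k

theorem line_fst (b : Bounds S) (hS : S.IsSolenoid) (m : ℕ → Fin S.d) (τ : ℝ) :
    (S.line m τ).1 = (τ : Circ) := b.back_line_fst hS m 0 τ

theorem eq_line (b : Bounds S) (hS : S.IsSolenoid) {m : ℕ → Fin S.d} {τ : ℝ} {p : Pt}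
    (hp : p ∈ S.Lam) (h : ∀ k, (S.back k p).1 = (S.G m k τ : Circ)) : p = S.line m τ := by
  have h1 := b.gap_le_of_back hS hp (b.line_mem hS m τ) h (fun k => b.back_line_fst hS m k τ)
    (δ := 0) (by simp)
  rw [mul_zero] at h1
  exact Prod.ext ((h 0).trans (b.line_fst hS m τ).symm) (b.eq_of_gap_le_zero h1)

theorem back_line (b : Bounds S) (hS : S.IsSolenoid) (m : ℕ → Fin S.d) (n : ℕ) (τ : ℝ) :
    S.back n (S.line m τ) = S.line (shift n m) (S.G m n τ) := by
  refine b.eq_line hS (hS.back_mem n (b.line_mem hS m τ)) fun k => ?_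
  rw [← back_add, b.back_line_fst hS, add_comm, G_add]

theorem gap_line_le (b : Bounds S) (hS : S.IsSolenoid) (m : ℕ → Fin S.d) (τ τ' : ℝ) :
    b.gap (S.line m τ).2 (S.line m τ').2 ≤ b.T * |τ - τ'| :=
  b.gap_le_of_back hS (b.line_mem hS m τ) (b.line_mem hS m τ')
    (fun k => b.back_line_fst hS m k τ) (fun k => b.back_line_fst hS m k τ')
    fun k => b.abs_G_sub_le' hS m k τ τ'

theorem dist_line_le (b : Bounds S) (hS : S.IsSolenoid) (m : ℕ → Fin S.d) (τ τ' : ℝ) :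
    dist (S.line m τ) (S.line m τ') ≤ (1 + b.T) * |τ - τ'| := by
  have hT := b.T_nonneg
  rw [Prod.dist_eq]
  refine max_le ?_ ((b.dist_le_gap _ _).trans ((b.gap_line_le hS m τ τ').trans ?_))
  · rw [b.line_fst hS, b.line_fst hS, dist_eq_norm, ← AddCircle.coe_sub]
    refine (QuotientAddGroup.norm_mk_le_norm).trans ?_
    rw [Real.norm_eq_abs]
    nlinarith [abs_nonneg (τ - τ')]
  · nlinarith [abs_nonneg (τ - τ')]

theorem isUnstableLine_line (b : Bounds S) (hS : S.IsSolenoid) (m : ℕ → Fin S.d) :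
    S.IsUnstableLine (S.line m) where
  continuous := (LipschitzWith.of_dist_le_mul (K := ⟨1 + b.T, by linarith [b.T_nonneg]⟩)
    fun x y => by rw [Real.dist_eq]; exact b.dist_line_le hS m x y).continuous
  proj := b.line_fst hS m
  mem := b.line_mem hS m
  unstable := fun s τ => by
    refine ⟨b.line_mem hS m τ, ?_⟩
    have hlim : Tendsto (fun n : ℕ => (1 + b.T) * (b.μ⁻¹ ^ n * |s - τ|)) atTop (𝓝 0) := by
      simpa using ((tendsto_pow_atTop_nhds_zero_of_lt_one b.μ_inv_pos.le b.μ_inv_lt).mul_const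
        |s - τ|).const_mul (1 + b.T)
    refine squeeze_zero (fun _ => dist_nonneg) (fun n => ?_) hlim
    rw [b.back_line hS, b.back_line hS]
    refine (b.dist_line_le hS _ _ _).trans ?_
    have := b.T_nonneg
    have := b.abs_G_sub_le hS m n s τ
    gcongr

/-- Every point of the solenoid lies on a line with some code. -/
theorem exists_line_eq (b : Bounds S) (hS : S.IsSolenoid) {v : Pt} {s : ℝ} (hv : v ∈ S.Lam)
    (hs : v.1 = (s : Circ)) : ∃ m : ℕ → Fin S.d, S.line m s = v := by
  -- a real lift of each preimage is chosen so that the symbol lies in `[0, d)`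
  have hstep : ∀ (k : ℕ) (t : ℝ), (S.back k v).1 = (t : Circ) →
      ∃ i : Fin S.d, (S.back (k + 1) v).1 = ((S.psi (t + 2 * π * (i : ℕ)) : ℝ) : Circ) := by
    intro k t ht
    let x : ℝ := AddCircle.equivIco (2 * π) (S.psi t) (S.back (k + 1) v).1
    have hx : x ∈ Ico (S.psi t) (S.psi t + 2 * π) :=
      (AddCircle.equivIco (2 * π) (S.psi t) (S.back (k + 1) v).1).2
    have hxc : (x : Circ) = (S.back (k + 1) v).1 := AddCircle.coe_equivIco
    have h1 : ((S.η x : ℝ) : Circ) = (t : Circ) := by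
      rw [← circ_coe, hxc, ← ht, ← hS.f_back k hv, f_fst]
    obtain ⟨n, hn⟩ := coe_eq_coe_iff.1 h1
    have h2 : t ≤ S.η x := by
      have := hS.strictMono_η.monotone hx.1
      rwa [hS.η_psi] at this
    have h3 : S.η x < t + S.d * (2 * π) := by
      have := hS.strictMono_η hx.2
      rwa [S.η_add, hS.η_psi] at this
    have hpi := Real.two_pi_pos
    have hn0 : 0 ≤ n := by
      by_contra! hc
      have : (n : ℝ) ≤ -1 := by exact_mod_cast (by omega : n ≤ -1)
      nlinarith
    have hnd : n < S.d := by
      by_contra! hc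
      have : (S.d : ℝ) ≤ n := by exact_mod_cast hc
      nlinarith
    obtain ⟨j, rfl⟩ := Int.eq_ofNat_of_zero_le hn0
    refine ⟨⟨j, by exact_mod_cast hnd⟩, ?_⟩
    rw [← hxc, ← hS.psi_η x, hn]
    simp
  have : Nonempty (Fin S.d) := ⟨⟨0, by have := S.one_lt_d; omega⟩⟩
  choose! i hi using hstep
  obtain ⟨r, hr0, hr⟩ : ∃ r : ℕ → ℝ, r 0 = s ∧
      ∀ k, r (k + 1) = S.psi (r k + 2 * π * (i k (r k) : ℕ)) :=
    ⟨fun k => Nat.rec s (fun k t => S.psi (t + 2 * π * (i k t : ℕ))) k, rfl, fun _ => rfl⟩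
  have hG : ∀ k, S.G (fun k => i k (r k)) k s = r k := by
    intro k
    induction k with
    | zero => exact hr0.symm
    | succ k ih => rw [G, ih, hr]
  have hback : ∀ k, (S.back k v).1 = (r k : Circ) := by
    intro k
    induction k with
    | zero => rw [hr0]; exact hs
    | succ k ih => rw [hr]; exact hi k _ ih
  exact ⟨fun k => i k (r k), (b.eq_line hS hv fun k => by rw [hG, hback]).symm⟩

/-- An unstable line through a point of `line m` is `line m`: its preimages are lifts along the
covering map of the circle that agree at one point. -/
theorem eq_line_of_isUnstableLine (b : Bounds S) (hS : S.IsSolenoid) {γ : ℝ → Pt} {s : ℝ}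
    {m : ℕ → Fin S.d} (hγ : S.IsUnstableLine γ) (h : γ s = S.line m s) : γ = S.line m := by
  obtain ⟨δ, hδ, hsep⟩ := b.exists_separation hS
  have hsm : IsSeparatedMap S.circ := T2Space.isSeparatedMap _
  have hinj : IsLocallyInjective S.circ := by
    intro x
    refine ⟨Metric.ball x (δ / 2), Metric.isOpen_ball, Metric.mem_ball_self (by linarith), ?_⟩
    intro y hy z hz hyz
    refine hsep y z hyz ?_
    have := dist_triangle_right y z x
    rw [Metric.mem_ball] at hy hz
    linarith
  have key : ∀ k, (fun τ => (S.back k (γ τ)).1) = fun τ => (S.G m k τ : Circ) := by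
    intro k
    induction k with
    | zero => exact funext hγ.proj
    | succ k ih =>
      refine hsm.eq_of_comp_eq hinj ?_ ?_ ?_ s ?_
      · exact continuous_fst.comp ((b.continuousOn_back hS (k + 1)).comp_continuous hγ.continuous
          hγ.mem)
      · exact (AddCircle.continuous_mk' _).comp (b.continuous_G hS m (k + 1))
      · funext τ
        simp only [Function.comp]
        rw [circ_G hS, ← f_fst, hS.f_back k (hγ.mem τ)]
        exact congrFun ih τ
      · rw [h, b.back_line_fst hS]
  exact funext fun τ => b.eq_line hS (hγ.mem τ) fun k => congrFun (key k) τ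

theorem existsUnique_isUnstableLine (b : Bounds S) (hS : S.IsSolenoid) {v : Pt} {s : ℝ}
    (hv : v ∈ S.Lam) (hs : v.1 = (s : Circ)) :
    ∃! γ : ℝ → Pt, S.IsUnstableLine γ ∧ γ s = v := by
  obtain ⟨m, rfl⟩ := b.exists_line_eq hS hv hs
  exact ⟨S.line m, ⟨b.isUnstableLine_line hS m, rfl⟩,
    fun γ h => b.eq_line_of_isUnstableLine hS h.1 h.2⟩

theorem hol_line (b : Bounds S) (hS : S.IsSolenoid) (m : ℕ → Fin S.d) (s t : ℝ) :
    S.hol s t (S.line m s) = S.line m t := by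
  have h : ∃ γ, S.IsUnstableLine γ ∧ γ s = S.line m s := ⟨_, b.isUnstableLine_line hS m, rfl⟩
  rw [hol, dif_pos h, b.eq_line_of_isUnstableLine hS h.choose_spec.1 h.choose_spec.2]

end Bounds

/-! ### Symbols and cylinders -/

theorem arc_unique {x : Circ} {i j : ℕ} (hi : x ∈ S.arc i) (hj : x ∈ S.arc j) : i = j := by
  have hpi := Real.two_pi_pos
  have h1 : 2 * π * i < 2 * π * (j + 1) := hi.1.trans_lt hj.2
  have h2 : 2 * π * j < 2 * π * (i + 1) := hj.1.trans_lt hi.2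
  have h3 : (i : ℝ) < j + 1 := lt_of_mul_lt_mul_left h1 hpi.le
  have h4 : (j : ℝ) < i + 1 := lt_of_mul_lt_mul_left h2 hpi.le
  have h5 : i < j + 1 := by exact_mod_cast h3
  have h6 : j < i + 1 := by exact_mod_cast h4
  omega

theorem rep_G (hS : S.IsSolenoid) (m : ℕ → Fin S.d) (k : ℕ) {τ : ℝ} (hτ : τ ∈ Ico 0 (2 * π)) :
    rep (S.G m k τ : Circ) = S.G m k τ :=
  rep_coe_of_mem (G_mem_Ico hS m k hτ)

theorem G_mem_arc (hS : S.IsSolenoid) (m : ℕ → Fin S.d) (k : ℕ) {τ : ℝ}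
    (hτ : τ ∈ Ico 0 (2 * π)) : (S.G m (k + 1) τ : Circ) ∈ S.arc (m k) := by
  have h := G_mem_Ico hS m k hτ
  change S.η (rep (S.G m (k + 1) τ : Circ)) ∈ Ico _ _
  rw [rep_G hS m (k + 1) hτ, η_G hS]
  constructor
  · linarith [h.1]
  · linarith [h.2]

namespace Bounds

theorem back_line_mem_arc_iff (b : Bounds S) (hS : S.IsSolenoid) (m : ℕ → Fin S.d) (k : ℕ) {τ : ℝ}
    (hτ : τ ∈ Ico 0 (2 * π)) (i : Fin S.d) :
    (S.back (k + 1) (S.line m τ)).1 ∈ S.arc i ↔ m k = i := by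
  rw [b.back_line_fst hS]
  have h := G_mem_arc hS m k hτ
  exact ⟨fun h' => Fin.ext (arc_unique h h'), fun h' => h' ▸ h⟩

end Bounds

theorem back_mem_vert_iff (hS : S.IsSolenoid) {p : Pt} (hp : p ∈ S.Lam) (n : ℕ)
    (w : Fin n → Fin S.d) :
    S.back n p ∈ S.vert n w ↔ ∀ k : Fin n, (S.back (n - k) p).1 ∈ S.arc (w k) := by
  have h : ∀ k : Fin n, S.f^[k] (S.back n p) = S.back (n - k) p := fun k => by
    have := hS.iterate_f_back k (n - k) hp
    rwa [Nat.sub_add_cancel k.2.le] at this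
  simp only [vert, mem_ofPred_eq, h]
  exact ⟨fun h => h.2, fun h' => ⟨hS.Lam_subset_M (hS.back_mem n hp), h'⟩⟩

theorem mem_horiz_iff (hS : S.IsSolenoid) {p : Pt} (hp : p ∈ S.Lam) (n : ℕ)
    (w : Fin (n + 1) → Fin S.d) :
    p ∈ S.horiz n w ↔ ∀ k : Fin (n + 1), (S.back (n + 1 - k) p).1 ∈ S.arc (w k) := by
  rw [← back_mem_vert_iff hS hp]
  constructor
  · rintro ⟨q, hq, rfl⟩
    have := hS.back_iterate (n + 1) 0 hq.1
    rw [add_zero] at this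
    rw [this]
    exact hq
  · intro h
    have := hS.iterate_f_back (n + 1) 0 hp
    rw [zero_add] at this
    exact ⟨_, h, this⟩

namespace Bounds

theorem line_mem_horiz_iff (b : Bounds S) (hS : S.IsSolenoid) (m : ℕ → Fin S.d) {τ : ℝ}
    (hτ : τ ∈ Ico 0 (2 * π)) (n : ℕ) (w : Fin (n + 1) → Fin S.d) :
    S.line m τ ∈ S.horiz n w ↔ ∀ k : Fin (n + 1), m (n - k) = w k := by
  rw [mem_horiz_iff hS (b.line_mem hS m τ)]
  refine forall_congr' fun k => ?_
  rw [Nat.sub_add_comm (Nat.le_of_lt_succ k.2), b.back_line_mem_arc_iff hS m _ hτ]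

theorem hasSymbol_line_iff (b : Bounds S) (hS : S.IsSolenoid) (m : ℕ → Fin S.d) (i : Fin S.d) :
    S.HasSymbol (S.line m) i ↔ m 0 = i := by
  constructor
  · intro h
    have h0 : (0 : ℝ) ∈ Ico 0 (2 * π) := ⟨le_rfl, Real.two_pi_pos⟩
    simpa using (b.line_mem_horiz_iff hS m h0 0 _).1 (h 0 h0) 0
  · intro h τ hτ
    rw [b.line_mem_horiz_iff hS m hτ]
    intro k
    simpa using h

theorem diffSymbol_line (b : Bounds S) (hS : S.IsSolenoid) {m m' : ℕ → Fin S.d}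
    (h : m 0 ≠ m' 0) : S.DiffSymbol (S.line m) (S.line m') :=
  ⟨m 0, m' 0, h, (b.hasSymbol_line_iff hS m _).2 rfl, (b.hasSymbol_line_iff hS m' _).2 rfl⟩

theorem line_mem_H_iff (b : Bounds S) (hS : S.IsSolenoid) (m m' : ℕ → Fin S.d) {τ : ℝ}
    (hτ : τ ∈ Ico 0 (2 * π)) (n : ℕ) :
    S.line m' τ ∈ S.H n (S.line m τ) ↔ ∀ j ≤ n, m j = m' j := by
  constructor
  · rintro ⟨w, h, h'⟩ j hj
    rw [b.line_mem_horiz_iff hS _ hτ] at h h'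
    have h1 := h ⟨n - j, by omega⟩
    have h2 := h' ⟨n - j, by omega⟩
    simp only [Nat.sub_sub_self hj] at h1 h2
    rw [h1, h2]
  · intro h
    refine ⟨fun k => m (n - k), (b.line_mem_horiz_iff hS _ hτ _ _).2 fun k => rfl,
      (b.line_mem_horiz_iff hS _ hτ _ _).2 fun k => (h _ (Nat.sub_le _ _)).symm⟩

theorem back_line_mem_V (b : Bounds S) (hS : S.IsSolenoid) (m : ℕ → Fin S.d) {τ τ' : ℝ}
    (hτ : τ ∈ Ico 0 (2 * π)) (hτ' : τ' ∈ Ico 0 (2 * π)) (n : ℕ) :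
    S.back n (S.line m τ') ∈ S.V n (S.back n (S.line m τ)) := by
  have key : ∀ t ∈ Ico 0 (2 * π), S.back n (S.line m t) ∈ S.vert n fun k => m (n - k - 1) := by
    intro t ht
    rw [back_mem_vert_iff hS (b.line_mem hS m t)]
    intro k
    have hk : n - (k : ℕ) = n - k - 1 + 1 := by omega
    rw [hk, b.back_line_mem_arc_iff hS m _ ht]
    simp
  exact ⟨_, key τ hτ, key τ' hτ'⟩

theorem etaProd_back_line (b : Bounds S) (hS : S.IsSolenoid) (m : ℕ → Fin S.d) {τ : ℝ}
    (hτ : τ ∈ Ico 0 (2 * π)) (n : ℕ) :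
    S.etaProd n (S.back n (S.line m τ)) =
      ∏ k ∈ Finset.range (n + 1), deriv S.η (S.G m k τ) := by
  rw [etaProd, ← Finset.prod_range_reflect]
  refine Finset.prod_congr rfl fun k hk => ?_
  have hk' : k ≤ n := Nat.lt_succ_iff.1 (Finset.mem_range.1 hk)
  have := hS.iterate_f_back (n - k) k (b.line_mem hS m τ)
  rw [show k + (n - k) = n by omega] at this
  rw [show n + 1 - 1 - k = n - k by omega, this, b.back_line_fst hS, rep_G hS m k hτ]

/-- The strong Lipschitz condition in terms of codes: over the `r`-neighbourhood of the base
interval of generation `n`, the line of the `n`-th preimage of the point does not cross lines with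
another symbol. -/
theorem eventually_of_strongLip (b : Bounds S) (hS : S.IsSolenoid) {m : ℕ → Fin S.d} {s L : ℝ}
    (hs : s ∈ Ico 0 (2 * π)) (h : S.StrongLip L (S.line m s)) :
    ∀ᶠ n : ℕ in atTop, ∀ m' : ℕ → Fin S.d, m n ≠ m' n → ∀ r : ℝ,
      r = L * (∏ k ∈ Finset.range (n + 1), deriv S.η (S.G m k s))⁻¹ →
      ∀ t ∈ Icc (-r) (2 * π + r), (S.line (shift n m) t).2.1 = (S.line (shift n m') t).2.1 →
        ∀ τ ∈ Icc 0 (2 * π), r ≤ |S.G m n τ - t| := by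
  filter_upwards [h.2] with n hn m' hm r hr t ht hy
  rw [← b.etaProd_back_line hS m hs] at hr
  have hIco : ∀ τ ∈ Ico 0 (2 * π), r ≤ |S.G m n τ - t| := by
    intro τ hτ
    have h1 := hn r hr _ (b.back_line_mem_V hS m hs hτ n) (t, S.line (shift n m) t)
      ⟨ht, S.line (shift n m), b.isUnstableLine_line hS _, ?_, rfl⟩
      ⟨ht, S.line (shift n m), S.line (shift n m'), b.isUnstableLine_line hS _,
        b.isUnstableLine_line hS _, b.diffSymbol_line hS hm, rfl, hy.symm⟩
    · rwa [b.back_line_fst hS, rep_G hS m n hτ] at h1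
    · rw [b.back_line_fst hS, rep_G hS m n hs, b.back_line hS]
  have hc : Continuous fun τ => |S.G m n τ - t| :=
    ((b.continuous_G hS m n).sub continuous_const).abs
  intro τ hτ
  have hcl : τ ∈ closure (Ico 0 (2 * π)) := by
    rwa [closure_Ico Real.two_pi_pos.ne]
  exact le_on_closure hIco continuousOn_const hc.continuousOn hcl

end Bounds

/-! ### The slope of the unstable lines -/

/-- The lift to the universal cover of the `k`-th preimage of the point of `line m` over `τ`. -/
def pt (S : TriMap) (m : ℕ → Fin S.d) (k : ℕ) (τ : ℝ) : ℝ × ℝ × ℝ :=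
  (S.G m k τ, (S.line (shift k m) (S.G m k τ)).2)

theorem shift_zero {d : ℕ} (m : ℕ → Fin d) : shift 0 m = m := by
  funext j; simp [shift]

theorem shift_shift {d : ℕ} (m : ℕ → Fin d) (k n : ℕ) : shift n (shift k m) = shift (k + n) m := by
  funext j; simp [shift, add_assoc]

theorem G_add_one (m : ℕ → Fin S.d) (k : ℕ) (τ : ℝ) :
    S.G m (k + 1) τ = S.G (shift k m) 1 (S.G m k τ) := G_add m k 1 τ

theorem pt_zero (m : ℕ → Fin S.d) (τ : ℝ) : S.pt m 0 τ = (τ, (S.line m τ).2) := by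
  rw [pt, shift_zero, G_zero]

/-- The function on `S¹ × ℝ × ℝ` induced by a periodic function on its universal cover. -/
def down (g : ℝ × ℝ × ℝ → ℝ) (p : Pt) : ℝ := g (rep p.1, p.2)

theorem down_coe {g : ℝ × ℝ × ℝ → ℝ} (hg : ∀ x y z, g (x + 2 * π, y, z) = g (x, y, z)) {p : Pt}
    {x : ℝ} (h : p.1 = (x : Circ)) : down g p = g (x, p.2) := by
  rw [down, h]
  exact periodic_rep (g := fun x => g (x, p.2)) (fun x => hg x _ _) x

theorem continuousOn_down {g : ℝ × ℝ × ℝ → ℝ} (hg : ∀ x y z, g (x + 2 * π, y, z) = g (x, y, z))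
    (hc : ContinuousOn g cover) : ContinuousOn (down g) M :=
  continuousOn_of_lift (fun _ => down_coe hg rfl) hc

namespace Bounds

theorem pt_mem_slab (b : Bounds S) (hS : S.IsSolenoid) (m : ℕ → Fin S.d) (k : ℕ) (τ : ℝ) :
    S.pt m k τ ∈ slab b.ρ :=
  b.Lam_subset_tube (b.line_mem hS (shift k m) (S.G m k τ))

theorem lift_pt (b : Bounds S) (hS : S.IsSolenoid) (m : ℕ → Fin S.d) (k : ℕ) (τ : ℝ) :
    (S.lift (S.pt m (k + 1) τ)).2 = (S.pt m k τ).2 := by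
  rw [pt, ← f_snd S (b.line_fst hS _ _), ← b.back_line hS, hS.f_back k (b.line_mem hS m τ),
    b.back_line hS]
  rfl

theorem dist_pt_le (b : Bounds S) (hS : S.IsSolenoid) (m : ℕ → Fin S.d) (k : ℕ) (τ τ' : ℝ) :
    dist (S.pt m k τ) (S.pt m k τ') ≤ (1 + b.T) * |S.G m k τ - S.G m k τ'| := by
  have hT := b.T_nonneg
  have h0 := abs_nonneg (S.G m k τ - S.G m k τ')
  rw [Prod.dist_eq]
  refine max_le ?_ ((b.dist_le_gap _ _).trans ((b.gap_line_le hS _ _ _).trans ?_))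
  · rw [Real.dist_eq]
    change |S.G m k τ - S.G m k τ'| ≤ _
    nlinarith
  · nlinarith

/-- The invariance equation for the slopes of the unstable lines has a continuous solution, as the
fixed point of a contraction. -/
theorem exists_invariant_slope (b : Bounds S) (hS : S.IsSolenoid) :
    ∃ σ : Pt → ℝ, ContinuousOn σ S.Lam ∧ ∀ p ∈ S.Lam, σ p * down S.dxx (S.back 1 p) =
      down S.dyx (S.back 1 p) + down S.dyy (S.back 1 p) * σ (S.back 1 p) := by
  have hK : CompactSpace S.Lam := isCompact_iff_compactSpace.1 (b.isCompact_Lam hS)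
  have hDp := IsSolenoid.fderiv_periodic S
  have hDv : ∀ v, ContinuousOn (fun P => fderiv ℝ S.lift P v) cover := fun v =>
    hS.continuousOn_fderiv.clm_apply continuousOn_const
  have hback : Continuous fun p : S.Lam => S.back 1 p :=
    (b.continuousOn_back hS 1).comp_continuous continuous_subtype_val fun p => p.2
  have hbM : ∀ p : S.Lam, S.back 1 p ∈ M := fun p => hS.Lam_subset_M (hS.back_mem 1 p.2)
  have hslab : ∀ p : S.Lam, (rep (S.back 1 p).1, (S.back 1 p).2) ∈ slab b.ρ := fun p =>
    b.Lam_subset_tube (hS.back_mem 1 p.2)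
  have cxx : Continuous fun p : S.Lam => down S.dxx (S.back 1 p) :=
    (continuousOn_down (fun x y z => by simp [hDp]) (hDv (1, 0, 0)).fst).comp_continuous
      hback hbM
  have cyx : Continuous fun p : S.Lam => down S.dyx (S.back 1 p) :=
    (continuousOn_down (fun x y z => by simp [hDp]) (hDv (1, 0, 0)).snd.fst).comp_continuous
      hback hbM
  have cyy : Continuous fun p : S.Lam => down S.dyy (S.back 1 p) :=
    (continuousOn_down (fun x y z => by simp [hDp]) (hDv (0, 1, 0)).snd.fst).comp_continuous
      hback hbM
  have hx : ∀ p : S.Lam, 1 < down S.dxx (S.back 1 p) := fun p =>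
    b.one_lt_μ.trans_le (b.le_dxx _ (hslab p))
  let bk : C(S.Lam, S.Lam) := ⟨fun p => ⟨S.back 1 p, hS.back_mem 1 p.2⟩, hback.subtype_mk _⟩
  let F : C(S.Lam, ℝ) → C(S.Lam, ℝ) := fun σ =>
    ⟨fun p => (down S.dyx (S.back 1 p) + down S.dyy (S.back 1 p) * σ (bk p)) /
      down S.dxx (S.back 1 p),
      (cyx.add (cyy.mul (σ.comp bk).continuous)).div cxx fun p => (one_pos.trans (hx p)).ne'⟩
  have hF : ContractingWith (Real.toNNReal b.ℓ) F := by
    refine ⟨Real.toNNReal_lt_one.2 b.ℓ_lt, LipschitzWith.of_dist_le_mul fun σ σ' => ?_⟩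
    rw [Real.coe_toNNReal _ b.ℓ_pos.le, ContinuousMap.dist_le (mul_nonneg b.ℓ_pos.le dist_nonneg)]
    intro p
    have h1 := hx p
    have h2 : (F σ) p - (F σ') p =
        down S.dyy (S.back 1 p) * (σ (bk p) - σ' (bk p)) / down S.dxx (S.back 1 p) := by
      simp only [F, ContinuousMap.coe_mk]
      ring
    have h3 : |down S.dyy (S.back 1 p)| ≤ b.ℓ := by
      rw [down, abs_of_nonneg (b.a₀_pos.le.trans (b.le_dyy _ (hslab p)))]
      exact b.dyy_le _ (hslab p)
    have h4 : |σ (bk p) - σ' (bk p)| ≤ dist σ σ' := by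
      rw [← Real.dist_eq]; exact ContinuousMap.dist_apply_le_dist _
    rw [Real.dist_eq, h2, abs_div, abs_mul, abs_of_pos (one_pos.trans h1)]
    refine (div_le_self (by positivity) h1.le).trans ?_
    have := b.ℓ_pos.le
    gcongr
  obtain ⟨σ, hσ, -⟩ := hF.exists_fixedPoint (0 : C(S.Lam, ℝ)) (edist_ne_top _ _)
  classical
  refine ⟨fun p => if h : p ∈ S.Lam then σ ⟨p, h⟩ else 0, ?_, fun p hp => ?_⟩
  · rw [continuousOn_iff_continuous_domRestrict]
    refine σ.continuous.congr fun p => ?_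
    rw [Set.domRestrict_apply, dif_pos p.2]
  · simp only [dif_pos hp, dif_pos (hS.back_mem 1 hp)]
    have h1 : F σ ⟨p, hp⟩ = σ ⟨p, hp⟩ := by rw [hσ]
    rw [← h1]
    exact div_mul_cancel₀ _ (one_pos.trans (hx ⟨p, hp⟩)).ne'

/-- A solution of the invariance equation is the slope of the `y`-coordinate of the unstable
lines: the error of the linear approximation satisfies a contracting recursion along backward
orbits, with a remainder of order `1 + α`. -/
theorem hasDerivAt_line (b : Bounds S) (hS : S.IsSolenoid) {σ : Pt → ℝ}
    (hσc : ContinuousOn σ S.Lam)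
    (hσ : ∀ p ∈ S.Lam, σ p * down S.dxx (S.back 1 p) =
      down S.dyx (S.back 1 p) + down S.dyy (S.back 1 p) * σ (S.back 1 p))
    (m : ℕ → Fin S.d) (τ : ℝ) :
    HasDerivAt (fun t => (S.line m t).2.1) (σ (S.line m τ)) τ := by
  have hDp := IsSolenoid.fderiv_periodic S
  obtain ⟨s, hs⟩ := (b.isCompact_Lam hS).exists_bound_of_continuousOn hσc
  have hs0 : 0 ≤ s := (norm_nonneg _).trans (hs _ (b.line_mem hS m 0))
  have hT := b.T_nonneg
  have hB := b.B_pos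
  have hH := b.H_nonneg
  have key : ∀ τ', |(S.line m τ').2.1 - (S.line m τ).2.1 - σ (S.line m τ) * (τ' - τ)| ≤
      b.H * ((1 + b.T) * |τ' - τ|) ^ b.α * (1 + 2 * s) * |τ' - τ| / (1 - b.ℓ) := by
    intro τ'
    let p : ℕ → Pt := fun k => S.line (shift k m) (S.G m k τ)
    have hp : ∀ k, p k ∈ S.Lam := fun k => b.line_mem hS _ _
    have hpb : ∀ k, S.back 1 (p k) = p (k + 1) := fun k => by
      simp only [p]
      rw [b.back_line hS, shift_shift, ← G_add_one]
    have hG : ∀ k, |S.G m k τ' - S.G m k τ| ≤ |τ' - τ| := fun k => b.abs_G_sub_le' hS m k τ' τ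
    have h := le_div_of_forall_le_mul_succ
      (e := fun k => |(S.pt m k τ').2.1 - (S.pt m k τ).2.1 -
        σ (p k) * (S.G m k τ' - S.G m k τ)|) (q := b.ℓ)
      (c := b.H * ((1 + b.T) * |τ' - τ|) ^ b.α * (1 + 2 * s) * |τ' - τ|)
      (E := 2 + s * |τ' - τ|) b.ℓ_pos.le b.ℓ_lt ?_ ?_
    · simpa only [pt_zero, p, shift_zero, G_zero] using h
    · intro k
      have h1 := (b.abs_le_one_of_mem_slab (b.pt_mem_slab hS m k τ')).1
      have h2 := (b.abs_le_one_of_mem_slab (b.pt_mem_slab hS m k τ)).1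
      refine (abs_sub _ _).trans ?_
      have h3 := (abs_sub (S.pt m k τ').2.1 (S.pt m k τ).2.1)
      have h4 : |σ (p k) * (S.G m k τ' - S.G m k τ)| ≤ s * |τ' - τ| := by
        rw [abs_mul]
        have := hs _ (hp k)
        rw [Real.norm_eq_abs] at this
        have := hG k
        gcongr
      linarith
    · intro k
      have hP := b.pt_mem_slab hS m (k + 1) τ
      have hP' := b.pt_mem_slab hS m (k + 1) τ'
      obtain ⟨ex, ey, -⟩ := hS.lift_sub b hP hP'
      have hd : dist (S.pt m (k + 1) τ') (S.pt m (k + 1) τ) ≤ (1 + b.T) * |τ' - τ| :=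
        (b.dist_pt_le hS m (k + 1) τ' τ).trans (by have := hG (k + 1); gcongr)
      have hself : dist (S.pt m (k + 1) τ) (S.pt m (k + 1) τ) ≤ (1 + b.T) * |τ' - τ| := by
        rw [dist_self]; positivity
      set δ := b.H * ((1 + b.T) * |τ' - τ|) ^ b.α with hδ
      have hδ0 : 0 ≤ δ := by positivity
      have vx := b.xx.abs_segAvg_sub_le b.α_pos hH hP hP' hP hP hself hd
      have vyx := b.yx.abs_segAvg_sub_le b.α_pos hH hP hP' hP hP hself hd
      have vyy := b.yy.abs_segAvg_sub_le b.α_pos hH hP hP' hP hP hself hd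
      rw [segAvg_self] at vx vyx vyy
      have hyy0 := b.yy.le_segAvg b.α_pos hP hP' b.le_dyy
      have hyy1 := b.yy.segAvg_le b.α_pos hP hP' b.dyy_le
      have hyy : |segAvg S.dyy (S.pt m (k + 1) τ) (S.pt m (k + 1) τ')| ≤ b.ℓ := by
        rwa [abs_of_nonneg (b.a₀_pos.le.trans hyy0)]
      rw [b.lift_pt hS, b.lift_pt hS] at ey
      have ex' : S.G m k τ' - S.G m k τ = S.η (S.G m (k + 1) τ') - S.η (S.G m (k + 1) τ) := by
        rw [η_G hS, η_G hS]; ring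
      have inv := hσ _ (hp k)
      have hfst : (p (k + 1)).1 = (S.G m (k + 1) τ : Circ) := b.line_fst hS _ _
      rw [hpb, down_coe (fun x y z => by simp [dxx, hDp]) hfst,
        down_coe (fun x y z => by simp [dyx, hDp]) hfst,
        down_coe (fun x y z => by simp [dyy, hDp]) hfst] at inv
      change σ (p k) * S.dxx (S.pt m (k + 1) τ) = S.dyx (S.pt m (k + 1) τ) +
        S.dyy (S.pt m (k + 1) τ) * σ (p (k + 1)) at inv
      have hs1 := hs _ (hp k)
      have hs2 := hs _ (hp (k + 1))
      rw [Real.norm_eq_abs] at hs1 hs2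
      have hGk := hG (k + 1)
      change S.η (S.G m (k + 1) τ') - S.η (S.G m (k + 1) τ) =
        _ * (S.G m (k + 1) τ' - S.G m (k + 1) τ) at ex
      change _ = _ * (S.G m (k + 1) τ' - S.G m (k + 1) τ) + _ at ey
      rw [← ex'] at ex
      generalize S.G m (k + 1) τ' - S.G m (k + 1) τ = h' at *
      generalize (S.pt m (k + 1) τ').2.1 - (S.pt m (k + 1) τ).2.1 = Δ at *
      generalize segAvg S.dxx (S.pt m (k + 1) τ) (S.pt m (k + 1) τ') = X at *
      generalize segAvg S.dyx (S.pt m (k + 1) τ) (S.pt m (k + 1) τ') = A at *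
      generalize segAvg S.dyy (S.pt m (k + 1) τ) (S.pt m (k + 1) τ') = Y at *
      generalize S.dxx (S.pt m (k + 1) τ) = X₀ at *
      generalize S.dyx (S.pt m (k + 1) τ) = A₀ at *
      generalize S.dyy (S.pt m (k + 1) τ) = Y₀ at *
      have e : (S.pt m k τ').2.1 - (S.pt m k τ).2.1 - σ (p k) * (S.G m k τ' - S.G m k τ) =
          Y * (Δ - σ (p (k + 1)) * h') +
            ((A - A₀) + (Y - Y₀) * σ (p (k + 1)) - σ (p k) * (X - X₀)) * h' := by
        rw [ey, ex]
        linear_combination -h' * inv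
      change |(S.pt m k τ').2.1 - (S.pt m k τ).2.1 - σ (p k) * (S.G m k τ' - S.G m k τ)| ≤ _
      rw [e]
      refine (abs_add_le _ _).trans ?_
      rw [abs_mul, abs_mul]
      have h5 : |(A - A₀) + (Y - Y₀) * σ (p (k + 1)) - σ (p k) * (X - X₀)| ≤ δ * (1 + 2 * s) := by
        refine (abs_sub _ _).trans ((add_le_add_left (abs_add_le _ _) _).trans ?_)
        rw [abs_mul, abs_mul]
        calc _ ≤ δ + δ * s + s * δ := by gcongr
          _ = _ := by ring
      gcongr
  rw [hasDerivAt_iff_tendsto]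
  set K : ℝ := b.H * (1 + b.T) ^ b.α * (1 + 2 * s) / (1 - b.ℓ) with hK
  have hlim : Tendsto (fun x' => K * |x' - τ| ^ b.α) (𝓝 τ) (𝓝 0) := by
    have h1 : Tendsto (fun x' => |x' - τ|) (𝓝 τ) (𝓝 0) := by
      have : ContinuousAt (fun x' => |x' - τ|) τ := by fun_prop
      simpa [ContinuousAt] using this
    have h2 := (h1.rpow_const (p := b.α) (Or.inr b.α_pos.le)).const_mul K
    simpa [Real.zero_rpow b.α_pos.ne'] using h2
  refine squeeze_zero (fun _ => by positivity) (fun x' => ?_) hlim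
  have h1 := key x'
  rw [Real.norm_eq_abs, Real.norm_eq_abs, smul_eq_mul, mul_comm (x' - τ)]
  have h2 : b.H * ((1 + b.T) * |x' - τ|) ^ b.α * (1 + 2 * s) * |x' - τ| / (1 - b.ℓ) =
      K * |x' - τ| ^ b.α * |x' - τ| := by
    rw [Real.mul_rpow (by positivity) (abs_nonneg _), hK]; ring
  rw [h2] at h1
  rcases eq_or_ne x' τ with rfl | hne
  · simp only [sub_self, abs_zero, inv_zero, zero_mul]
    have := b.ℓ_lt
    have : 0 < 1 - b.ℓ := by linarith
    positivity
  · have : 0 < |x' - τ| := abs_pos.2 (sub_ne_zero.2 hne)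
    rw [inv_mul_le_iff₀ this]
    linarith

theorem exists_slope (b : Bounds S) (hS : S.IsSolenoid) :
    ∃ σ : Pt → ℝ, ContinuousOn σ S.Lam ∧ ∀ (m : ℕ → Fin S.d) (τ : ℝ),
      HasDerivAt (fun t => (S.line m t).2.1) (σ (S.line m τ)) τ := by
  obtain ⟨σ, hc, h⟩ := b.exists_invariant_slope hS
  exact ⟨σ, hc, b.hasDerivAt_line hS hc h⟩

end Bounds

end TriMap

/-! ### Uniform transversality -/

/-- A function that is small at a point, but whose derivative is not small nearby, has a zero
nearby. -/
theorem exists_zero_near {Δ Δ' : ℝ → ℝ} (hΔ : ∀ t, HasDerivAt Δ (Δ' t) t) {t₀ r c : ℝ}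
    (hr : 0 < r) (hr1 : r ≤ 1) (h : 4 * c ≤ |Δ t₀| + |Δ' t₀|)
    (hΔ' : ∀ t, |t - t₀| ≤ r → |Δ' t - Δ' t₀| ≤ c) (hs : |Δ t₀| < c * r) :
    ∃ t, |t - t₀| < r ∧ Δ t = 0 := by
  -- the sign of the derivative at `t₀` may be taken to be positive
  wlog hpos : 0 ≤ Δ' t₀ generalizing Δ Δ'
  · obtain ⟨t, ht, h0⟩ := this (Δ := fun t => -Δ t) (Δ' := fun t => -Δ' t)
      (fun t => (hΔ t).neg) (by simpa using h)
      (fun t ht => by rw [neg_sub_neg, abs_sub_comm]; exact hΔ' t ht) (by simpa using hs)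
      (by linarith)
    exact ⟨t, ht, by simpa using h0⟩
  have hc : 0 < c := by
    by_contra! hc
    linarith [abs_nonneg (Δ t₀), mul_nonpos_of_nonpos_of_nonneg hc hr.le]
  rw [abs_of_nonneg hpos] at h
  have hcr : c * r ≤ c := mul_le_of_le_one_right hc.le hr1
  have hd : ∀ t, |t - t₀| ≤ r → c ≤ Δ' t := fun t ht => by
    linarith [(abs_le.1 (hΔ' t ht)).1]
  have hcont : Continuous Δ := continuous_iff_continuousAt.2 fun t => (hΔ t).continuousAt
  have hmvt : ∀ x ∈ Icc (t₀ - r) (t₀ + r), ∀ y ∈ Icc (t₀ - r) (t₀ + r), x ≤ y →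
      c * (y - x) ≤ Δ y - Δ x :=
    (convex_Icc _ _).mul_sub_le_image_sub_of_le_deriv hcont.continuousOn
      (fun x _ => (hΔ x).differentiableAt.differentiableWithinAt) (fun x hx => by
        rw [(hΔ x).deriv]
        rw [interior_Icc] at hx
        exact hd x (abs_le.2 ⟨by linarith [hx.1], by linarith [hx.2]⟩))
  obtain ⟨hs1, hs2⟩ := abs_lt.1 hs
  have ha := hmvt (t₀ - r) ⟨le_rfl, by linarith⟩ t₀ ⟨by linarith, by linarith⟩ (by linarith)
  have hb := hmvt t₀ ⟨by linarith, by linarith⟩ (t₀ + r) ⟨by linarith, le_rfl⟩ (by linarith)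
  obtain ⟨t, ht, h0⟩ := intermediate_value_Ioo (by linarith : t₀ - r ≤ t₀ + r)
    hcont.continuousOn (show (0 : ℝ) ∈ Ioo _ _ from ⟨by linarith, by linarith⟩)
  exact ⟨t, abs_lt.2 ⟨by linarith [ht.1], by linarith [ht.2]⟩, h0⟩

namespace TriMap

variable {S : TriMap}

theorem η_add_int (S : TriMap) (x : ℝ) (n : ℤ) :
    S.η (x + 2 * π * n) = S.η x + S.d * (2 * π * n) := by
  have hp : Function.Periodic (fun x => S.η x - S.d * x) (2 * π) := fun x => by
    simp only [S.η_add]; ring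
  have h : S.η (x + n * (2 * π)) - S.d * (x + n * (2 * π)) = S.η x - S.d * x := hp.int_mul n x
  rw [mul_comm (n : ℝ)] at h
  linarith

namespace Bounds

theorem G_one_ne (hS : S.IsSolenoid) {m m' : ℕ → Fin S.d} (h : m 0 ≠ m' 0) (τ : ℝ) :
    (S.G m 1 τ : Circ) ≠ (S.G m' 1 τ : Circ) := by
  intro he
  obtain ⟨n, hn⟩ := coe_eq_coe_iff.1 he
  have h1 := congrArg S.η hn
  rw [S.η_add_int, η_G hS, η_G hS, G_zero, G_zero] at h1
  have h2 : ((m 0 : ℕ) : ℝ) = (m' 0 : ℕ) + S.d * n := by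
    have hpi := Real.two_pi_pos
    refine mul_left_cancel₀ hpi.ne' ?_
    linarith
  have h3 : ((m 0 : ℕ) : ℤ) = (m' 0 : ℕ) + S.d * n := by exact_mod_cast h2
  have h4 := (m 0).2
  have h5 := (m' 0).2
  have hn0 : n = 0 := by
    by_contra hne
    rcases lt_or_gt_of_ne hne with hlt | hlt
    · nlinarith
    · nlinarith
  rw [hn0] at h3
  exact h (Fin.ext (by simpa using h3))

/-- By compactness, two lines with different symbols that are close to each other have
well-separated slopes. -/
theorem exists_transversality (b : Bounds S) (hS : S.IsSolenoid) (hT : S.Transversal)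
    {σ : Pt → ℝ} (hσc : ContinuousOn σ S.Lam) (hσ : ∀ (m : ℕ → Fin S.d) (τ : ℝ),
      HasDerivAt (fun t => (S.line m t).2.1) (σ (S.line m τ)) τ) :
    ∃ c > 0, ∀ m m' : ℕ → Fin S.d, m 0 ≠ m' 0 → ∀ τ, c ≤
      |(S.line m τ).2.1 - (S.line m' τ).2.1| + |σ (S.line m τ) - σ (S.line m' τ)| := by
  obtain ⟨δ, hδ, hsep⟩ := b.exists_separation hS
  let K : Set (Pt × Pt) := ((S.Lam ×ˢ S.Lam) ∩ {x | x.1.1 = x.2.1}) ∩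
    ((S.Lam ×ˢ S.Lam) ∩ (fun x : Pt × Pt => dist (S.back 1 x.1).1 (S.back 1 x.2).1) ⁻¹' Ici δ)
  have hLam := b.isCompact_Lam hS
  have h1 : ContinuousOn (fun x : Pt × Pt => S.back 1 x.1) (S.Lam ×ˢ S.Lam) :=
    (b.continuousOn_back hS 1).comp continuousOn_fst fun x hx => hx.1
  have h2 : ContinuousOn (fun x : Pt × Pt => S.back 1 x.2) (S.Lam ×ˢ S.Lam) :=
    (b.continuousOn_back hS 1).comp continuousOn_snd fun x hx => hx.2
  have hK : IsCompact K := by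
    refine ((hLam.prod hLam).inter_right (isClosed_eq (by fun_prop) (by fun_prop))).inter_right ?_
    have hd := continuous_dist.comp_continuousOn (h1.fst.prodMk h2.fst)
    exact hd.preimage_isClosed_of_isClosed (hLam.prod hLam).isClosed isClosed_Ici
  have hmem : ∀ m m' : ℕ → Fin S.d, m 0 ≠ m' 0 → ∀ τ, (S.line m τ, S.line m' τ) ∈ K := by
    intro m m' hm τ
    have hl : (S.line m τ, S.line m' τ) ∈ S.Lam ×ˢ S.Lam :=
      ⟨b.line_mem hS m τ, b.line_mem hS m' τ⟩
    refine ⟨⟨hl, (b.line_fst hS m τ).trans (b.line_fst hS m' τ).symm⟩, hl, ?_⟩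
    by_contra hlt
    have hlt' : dist (S.back 1 (S.line m τ)).1 (S.back 1 (S.line m' τ)).1 < δ := not_le.1 hlt
    rw [b.back_line_fst hS, b.back_line_fst hS] at hlt'
    exact G_one_ne hS hm τ (hsep _ _ (by rw [circ_G hS, circ_G hS]; rfl) hlt')
  rcases K.eq_empty_or_nonempty with hKe | hKn
  · refine ⟨1, one_pos, fun m m' hm τ => ?_⟩
    have := hmem m m' hm τ
    rw [hKe] at this
    exact this.elim
  have hKL : K ⊆ S.Lam ×ˢ S.Lam := fun x hx => hx.1.1
  have hφ : ContinuousOn (fun x : Pt × Pt => |x.1.2.1 - x.2.2.1| + |σ x.1 - σ x.2|) K := by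
    have c1 : ContinuousOn (fun x : Pt × Pt => σ x.1) K :=
      hσc.comp continuousOn_fst fun x hx => (hKL hx).1
    have c2 : ContinuousOn (fun x : Pt × Pt => σ x.2) K :=
      hσc.comp continuousOn_snd fun x hx => (hKL hx).2
    exact (Continuous.continuousOn (by fun_prop)).add (c1.sub c2).abs
  obtain ⟨x, hx, hmin⟩ := hK.exists_isMinOn hKn hφ
  refine ⟨_, ?_, fun m m' hm τ => hmin (hmem m m' hm τ)⟩
  by_contra! hle
  have hy : |x.1.2.1 - x.2.2.1| = 0 :=
    le_antisymm (by linarith [abs_nonneg (σ x.1 - σ x.2)]) (abs_nonneg _)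
  have hs : |σ x.1 - σ x.2| = 0 :=
    le_antisymm (by linarith [abs_nonneg (x.1.2.1 - x.2.2.1)]) (abs_nonneg _)
  rw [abs_eq_zero, sub_eq_zero] at hy hs
  have hrep := rep_mem x.1.1
  obtain ⟨m, hm⟩ := b.exists_line_eq hS (hKL hx).1 (coe_rep x.1.1).symm
  obtain ⟨m', hm'⟩ := b.exists_line_eq hS (hKL hx).2
    ((show x.1.1 = x.2.1 from hx.1.2).symm.trans (coe_rep x.1.1).symm)
  have hne : m 0 ≠ m' 0 := by
    intro he
    have hd : δ ≤ dist (S.back 1 x.1).1 (S.back 1 x.2).1 := hx.2.2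
    rw [← hm, ← hm', b.back_line_fst hS, b.back_line_fst hS,
      G_congr (m := m) (m' := m') (n := 1) (fun j hj => by rw [Nat.lt_one_iff.1 hj, he]),
      dist_self] at hd
    linarith
  refine hT _ _ (b.isUnstableLine_line hS m) (b.isUnstableLine_line hS m')
    (b.diffSymbol_line hS hne) (rep x.1.1) ⟨hrep.1, hrep.2.le⟩ (by rw [hm, hm', hy])
    (σ x.1) ⟨?_, ?_⟩
  · have := hσ m (rep x.1.1)
    rwa [hm] at this
  · have := hσ m' (rep x.1.1)
    rwa [hm', ← hs] at this

/-- Two lines with different symbols that are closer than `c r` over `t₀`, in the `y`-coordinate,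
cross at a distance less than `r` from `t₀`. -/
theorem exists_crossing (b : Bounds S) (hS : S.IsSolenoid) (hT : S.Transversal) :
    ∃ c > 0, ∃ r₀ > 0, ∀ m m' : ℕ → Fin S.d, m 0 ≠ m' 0 → ∀ t₀ r : ℝ, 0 < r → r ≤ r₀ →
      |(S.line m t₀).2.1 - (S.line m' t₀).2.1| < c * r →
        ∃ t, |t - t₀| < r ∧ (S.line m t).2.1 = (S.line m' t).2.1 := by
  obtain ⟨σ, hσc, hσ⟩ := b.exists_slope hS
  obtain ⟨c, hc, htr⟩ := b.exists_transversality hS hT hσc hσ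
  have huc := (b.isCompact_Lam hS).uniformContinuousOn_of_continuous hσc
  obtain ⟨δ, hδ, hσδ⟩ := Metric.uniformContinuousOn_iff.1 huc (c / 8) (by positivity)
  have hTn := b.T_nonneg
  refine ⟨c / 4, by positivity, min 1 (δ / 2 / (1 + b.T)), by positivity, ?_⟩
  intro m m' hm t₀ r hr hr0 hlt
  have hnear : ∀ (m : ℕ → Fin S.d) (t : ℝ), |t - t₀| ≤ r →
      |σ (S.line m t) - σ (S.line m t₀)| ≤ c / 8 := by
    intro m t ht
    have hd : dist (S.line m t) (S.line m t₀) < δ := by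
      refine (b.dist_line_le hS m t t₀).trans_lt ?_
      have h1 : |t - t₀| ≤ δ / 2 / (1 + b.T) := ht.trans (hr0.trans (min_le_right _ _))
      rw [le_div_iff₀ (by positivity)] at h1
      linarith
    exact (hσδ _ (b.line_mem hS m t) _ (b.line_mem hS m t₀) hd).le
  have hder : ∀ t, |t - t₀| ≤ r → |σ (S.line m t) - σ (S.line m' t) -
      (σ (S.line m t₀) - σ (S.line m' t₀))| ≤ c / 4 := by
    intro t ht
    have h1 := hnear m t ht
    have h2 := hnear m' t ht
    have : σ (S.line m t) - σ (S.line m' t) - (σ (S.line m t₀) - σ (S.line m' t₀)) =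
        (σ (S.line m t) - σ (S.line m t₀)) - (σ (S.line m' t) - σ (S.line m' t₀)) := by ring
    rw [this]
    exact (abs_sub _ _).trans (by linarith)
  obtain ⟨t, ht, h0⟩ := exists_zero_near (Δ := fun t => (S.line m t).2.1 - (S.line m' t).2.1)
    (Δ' := fun t => σ (S.line m t) - σ (S.line m' t)) (fun t => (hσ m t).sub (hσ m' t))
    hr (hr0.trans (min_le_left _ _)) (by linarith [htr m m' hm t₀]) hder hlt
  exact ⟨t, ht, sub_eq_zero.1 h0⟩

end Bounds

end TriMap

/-! ### Products along orbits -/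

theorem eq_prod_mul {u a : ℕ → ℝ} {N : ℕ} (h : ∀ j < N, u j = a j * u (j + 1)) :
    u 0 = (∏ j ∈ Finset.range N, a j) * u N := by
  induction N with
  | zero => simp
  | succ N ih =>
    rw [ih fun j hj => h j (by omega), h N (by omega), Finset.prod_range_succ, mul_assoc]

/-- A lower triangular recursion whose second diagonal entry is dominated by the first one: up to
a multiple of the first component, the second component is transported by its diagonal entries.
The multiple is the fixed point of `E ↦ B / a₀ + κ E`. -/
theorem abs_sub_prod_mul_le {a₀ B κ : ℝ} (ha₀ : 0 < a₀) (hκ : κ < 1) (hB : 0 ≤ B) {N : ℕ}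
    {u v a β γ : ℕ → ℝ} (hu : ∀ j < N, u j = a j * u (j + 1))
    (hv : ∀ j < N, v j = β j * u (j + 1) + γ j * v (j + 1)) (ha : ∀ j < N, a₀ ≤ a j)
    (hβ : ∀ j < N, |β j| ≤ B) (hγ0 : ∀ j < N, 0 ≤ γ j) (hγ : ∀ j < N, γ j ≤ κ * a j) :
    |v 0 - (∏ j ∈ Finset.range N, γ j) * v N| ≤ B / (a₀ * (1 - κ)) * |u 0| := by
  have h1 : 0 < 1 - κ := by linarith
  induction N generalizing u v a β γ with
  | zero => simp; positivity
  | succ N ih =>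
    have hE : 0 ≤ B / (a₀ * (1 - κ)) := by positivity
    have hih := ih (u := fun j => u (j + 1)) (v := fun j => v (j + 1)) (a := fun j => a (j + 1))
      (β := fun j => β (j + 1)) (γ := fun j => γ (j + 1)) (fun j hj => hu _ (by omega))
      (fun j hj => hv _ (by omega)) (fun j hj => ha _ (by omega)) (fun j hj => hβ _ (by omega))
      (fun j hj => hγ0 _ (by omega)) (fun j hj => hγ _ (by omega))
    simp only [zero_add] at hih
    have hu0 := hu 0 (by omega)
    have hv0 := hv 0 (by omega)
    have ha0 := ha 0 (by omega)
    have hβ0 := hβ 0 (by omega)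
    have hγ00 := hγ0 0 (by omega)
    have hγ' := hγ 0 (by omega)
    rw [zero_add] at hu0 hv0
    have e : v 0 - (∏ j ∈ Finset.range (N + 1), γ j) * v (N + 1) =
        β 0 * u 1 + γ 0 * (v 1 - (∏ j ∈ Finset.range N, γ (j + 1)) * v (N + 1)) := by
      rw [Finset.prod_range_succ', hv0]; ring
    have ha0' : 0 < a 0 := ha₀.trans_le ha0
    rw [e, hu0, abs_mul, abs_of_pos ha0']
    refine (abs_add_le _ _).trans ?_
    rw [abs_mul, abs_mul, abs_of_nonneg hγ00]
    calc |β 0| * |u 1| + γ 0 * |v 1 - (∏ j ∈ Finset.range N, γ (j + 1)) * v (N + 1)|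
        ≤ B * |u 1| + κ * a 0 * (B / (a₀ * (1 - κ)) * |u 1|) := by
          gcongr
          exact hγ00.trans hγ'
      _ ≤ B / a₀ * a 0 * |u 1| + κ * a 0 * (B / (a₀ * (1 - κ)) * |u 1|) := by
          gcongr
          rw [div_mul_eq_mul_div, le_div_iff₀ ha₀]
          gcongr
      _ = B / (a₀ * (1 - κ)) * (a 0 * |u 1|) := by
          field_simp
          ring

theorem prod_le_exp_mul_prod {x y : ℕ → ℝ} {D θ : ℝ} {N : ℕ} (hD : 0 ≤ D) (hθ0 : 0 ≤ θ)
    (hθ1 : θ < 1) (hx : ∀ j < N, 0 ≤ x j) (hy : ∀ j < N, 0 ≤ y j)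
    (hxy : ∀ j < N, x j ≤ y j * (1 + D * θ ^ (j + 1))) :
    ∏ j ∈ Finset.range N, x j ≤ Real.exp (D / (1 - θ)) * ∏ j ∈ Finset.range N, y j := by
  have h1 : ∏ j ∈ Finset.range N, x j ≤
      ∏ j ∈ Finset.range N, (y j * Real.exp (D * θ ^ (j + 1))) := by
    refine Finset.prod_le_prod (fun j hj => hx j (Finset.mem_range.1 hj)) fun j hj => ?_
    have hj' := Finset.mem_range.1 hj
    refine (hxy j hj').trans (mul_le_mul_of_nonneg_left ?_ (hy j hj'))
    rw [add_comm]
    exact Real.add_one_le_exp _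
  refine h1.trans ?_
  rw [Finset.prod_mul_distrib, ← Real.exp_sum, ← Finset.mul_sum, mul_comm]
  have h2 : ∑ j ∈ Finset.range N, θ ^ (j + 1) ≤ (1 - θ)⁻¹ := by
    rw [← tsum_geometric_of_lt_one hθ0 hθ1]
    refine le_trans (Finset.sum_le_sum fun j _ => ?_)
      ((summable_geometric_of_lt_one hθ0 hθ1).sum_le_tsum (Finset.range N)
        fun j _ => pow_nonneg hθ0 j)
    exact pow_le_pow_of_le_one hθ0 hθ1.le (Nat.le_succ j)
  have h3 : 0 ≤ ∏ j ∈ Finset.range N, y j :=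
    Finset.prod_nonneg fun j hj => hy j (Finset.mem_range.1 hj)
  rw [div_eq_mul_inv]
  gcongr

namespace TriMap

variable {S : TriMap}

namespace Bounds

/-- The rate `μ^{-α}` at which Hölder functions vary along backward orbits. -/
def θ (b : Bounds S) : ℝ := b.μ⁻¹ ^ b.α

theorem θ_nonneg (b : Bounds S) : 0 ≤ b.θ := Real.rpow_nonneg b.μ_inv_pos.le _

theorem θ_lt (b : Bounds S) : b.θ < 1 := Real.rpow_lt_one b.μ_inv_pos.le b.μ_inv_lt b.α_pos

/-- A common lower bound of the diagonal entries of the differential. -/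
def low (b : Bounds S) : ℝ := min 1 (min b.a₀ b.c₀)

theorem low_pos (b : Bounds S) : 0 < b.low := lt_min one_pos (lt_min b.a₀_pos b.c₀_pos)

/-- The constant of bounded distortion for the diagonal entries of the differential. -/
def K (b : Bounds S) : ℝ :=
  Real.exp (b.H * ((1 + b.T) * (2 * π)) ^ b.α / b.low / (1 - b.θ))

theorem one_le_K (b : Bounds S) : 1 ≤ b.K := by
  have h1 := b.H_nonneg
  have h2 := b.T_nonneg
  have h3 := b.low_pos
  have h4 : 0 < 1 - b.θ := by linarith [b.θ_lt]
  exact Real.one_le_exp (by positivity)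

/-- Bounded distortion: products of averages of a positive Hölder function along two backward
orbits of pairs of points that converge exponentially are comparable. -/
theorem prod_segAvg_le (b : Bounds S) {g : ℝ × ℝ × ℝ → ℝ} (hg : Tame b.ρ b.B b.H b.α g)
    (hlow : ∀ P ∈ slab b.ρ, b.low ≤ g P) {P Q P' Q' : ℕ → ℝ × ℝ × ℝ} {N : ℕ}
    (hP : ∀ k, P k ∈ slab b.ρ) (hQ : ∀ k, Q k ∈ slab b.ρ) (hP' : ∀ k, P' k ∈ slab b.ρ)
    (hQ' : ∀ k, Q' k ∈ slab b.ρ)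
    (h1 : ∀ k, dist (P k) (P' k) ≤ (1 + b.T) * (2 * π) * b.μ⁻¹ ^ k)
    (h2 : ∀ k, dist (Q k) (Q' k) ≤ (1 + b.T) * (2 * π) * b.μ⁻¹ ^ k) :
    ∏ k ∈ Finset.range N, segAvg g (P (k + 1)) (Q (k + 1)) ≤
      b.K * ∏ k ∈ Finset.range N, segAvg g (P' (k + 1)) (Q' (k + 1)) := by
  have hH := b.H_nonneg
  have hT := b.T_nonneg
  have hl := b.low_pos
  have hpos : ∀ {P Q : ℝ × ℝ × ℝ}, P ∈ slab b.ρ → Q ∈ slab b.ρ → b.low ≤ segAvg g P Q :=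
    fun hP hQ => hg.le_segAvg b.α_pos hP hQ hlow
  refine prod_le_exp_mul_prod (by positivity) b.θ_nonneg b.θ_lt
    (fun j _ => hl.le.trans (hpos (hP _) (hQ _))) (fun j _ => hl.le.trans (hpos (hP' _) (hQ' _)))
    fun j _ => ?_
  have h3 := hg.abs_segAvg_sub_le b.α_pos hH (hP (j + 1)) (hQ _) (hP' _) (hQ' _) (h1 _) (h2 _)
  have h4 : ((1 + b.T) * (2 * π) * b.μ⁻¹ ^ (j + 1)) ^ b.α =
      ((1 + b.T) * (2 * π)) ^ b.α * b.θ ^ (j + 1) := by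
    have := b.μ_inv_pos
    rw [Real.mul_rpow (by positivity) (by positivity), θ, ← Real.rpow_natCast,
      ← Real.rpow_natCast, ← Real.rpow_mul this.le, ← Real.rpow_mul this.le, mul_comm b.α]
  rw [h4] at h3
  have h5 := hpos (hP' (j + 1)) (hQ' (j + 1))
  have h6 := b.θ_nonneg
  have h7 : b.H * (((1 + b.T) * (2 * π)) ^ b.α * b.θ ^ (j + 1)) ≤
      segAvg g (P' (j + 1)) (Q' (j + 1)) *
        (b.H * ((1 + b.T) * (2 * π)) ^ b.α / b.low * b.θ ^ (j + 1)) := by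
    calc _ = b.low * (b.H * ((1 + b.T) * (2 * π)) ^ b.α / b.low * b.θ ^ (j + 1)) := by
          field_simp
      _ ≤ _ := by gcongr
  linarith [(abs_le.1 h3).2]

theorem dist_pt_le_pow (b : Bounds S) (hS : S.IsSolenoid) (m : ℕ → Fin S.d) (k : ℕ) {τ τ' : ℝ}
    (hτ : τ ∈ Icc 0 (2 * π)) (hτ' : τ' ∈ Icc 0 (2 * π)) :
    dist (S.pt m k τ) (S.pt m k τ') ≤ (1 + b.T) * (2 * π) * b.μ⁻¹ ^ k := by
  have h : |τ - τ'| ≤ 2 * π := abs_le.2 ⟨by linarith [hτ.1, hτ'.2], by linarith [hτ.2, hτ'.1]⟩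
  have hT := b.T_nonneg
  have hμ := b.μ_inv_pos
  calc _ ≤ (1 + b.T) * |S.G m k τ - S.G m k τ'| := b.dist_pt_le hS m k τ τ'
    _ ≤ (1 + b.T) * (b.μ⁻¹ ^ k * (2 * π)) := by
      gcongr
      exact (b.abs_G_sub_le hS m k τ τ').trans (by gcongr)
    _ = _ := by ring

/-- The length of a base interval of generation `N` is at most a constant times the inverse of the
derivative of the `N`-th iterate of `η` at any of its points. -/
theorem abs_G_sub_mul_prod_le (b : Bounds S) (hS : S.IsSolenoid) (m : ℕ → Fin S.d) (N : ℕ)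
    {s t t' : ℝ} (hs : s ∈ Icc 0 (2 * π)) (ht : t ∈ Icc 0 (2 * π)) (ht' : t' ∈ Icc 0 (2 * π)) :
    |S.G m N t - S.G m N t'| * ∏ k ∈ Finset.range N, deriv S.η (S.G m (k + 1) s) ≤
      b.K * (2 * π) := by
  have hsl := b.pt_mem_slab hS m
  have h1 := eq_prod_mul (u := fun k => S.G m k t - S.G m k t') (N := N)
    (a := fun k => segAvg S.dxx (S.pt m (k + 1) t') (S.pt m (k + 1) t)) fun k _ => by
      have := (hS.lift_sub b (hsl (k + 1) t') (hsl (k + 1) t)).1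
      change S.η (S.G m (k + 1) t) - S.η (S.G m (k + 1) t') = _ at this
      rw [η_G hS, η_G hS, add_sub_add_right_eq_sub] at this
      exact this
  have h2 := b.prod_segAvg_le b.xx
    (fun P hP => (min_le_left _ _).trans (b.one_lt_μ.le.trans (b.le_dxx P hP))) (N := N)
    (fun k => hsl k s) (fun k => hsl k s) (fun k => hsl k t') (fun k => hsl k t)
    (fun k => b.dist_pt_le_pow hS m k hs ht') (fun k => b.dist_pt_le_pow hS m k hs ht)
  have h3 : ∏ k ∈ Finset.range N, segAvg S.dxx (S.pt m (k + 1) s) (S.pt m (k + 1) s) =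
      ∏ k ∈ Finset.range N, deriv S.η (S.G m (k + 1) s) :=
    Finset.prod_congr rfl fun k _ => by
      rw [segAvg_self, hS.dxx_eq (slab_subset_cover b.ρ_nonneg b.ρ_lt (hsl _ _))]; rfl
  rw [h3] at h2
  have h4 : 0 ≤ ∏ k ∈ Finset.range N, segAvg S.dxx (S.pt m (k + 1) t') (S.pt m (k + 1) t) :=
    Finset.prod_nonneg fun k _ => b.μ_pos.le.trans
      (b.xx.le_segAvg b.α_pos (hsl _ _) (hsl _ _) b.le_dxx)
  have h5 : |t - t'| ≤ 2 * π := abs_le.2 ⟨by linarith [ht.1, ht'.2], by linarith [ht.2, ht'.1]⟩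
  have hK := zero_le_one.trans b.one_le_K
  calc _ ≤ |S.G m N t - S.G m N t'| * (b.K *
        ∏ k ∈ Finset.range N, segAvg S.dxx (S.pt m (k + 1) t') (S.pt m (k + 1) t)) := by gcongr
    _ = b.K * |t - t'| := by
      simp only [G_zero] at h1
      rw [h1, abs_mul, abs_of_nonneg h4]; ring
    _ ≤ _ := by gcongr

/-- At the level at which the codes of two lines separate, the strong Lipschitz condition bounds
the distance of the lines from below by a multiple of the length of the base interval, so that the
difference of the lines varies little over this interval. -/
theorem exists_relative_variation (b : Bounds S) (hS : S.IsSolenoid) (hT : S.Transversal) :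
    ∃ D : ℝ, 0 ≤ D ∧ ∀ L > 0, ∀ s ∈ Ico 0 (2 * π), ∀ m : ℕ → Fin S.d,
      S.StrongLip L (S.line m s) → ∀ᶠ N : ℕ in atTop, ∀ m' : ℕ → Fin S.d,
        (∀ j < N, m j = m' j) → m N ≠ m' N → ∀ t ∈ Icc 0 (2 * π), ∀ t' ∈ Icc 0 (2 * π),
          |((S.pt m' N t).2.1 - (S.pt m N t).2.1) - ((S.pt m' N t').2.1 - (S.pt m N t').2.1)| ≤
            D / L * |(S.pt m' N t').2.1 - (S.pt m N t').2.1| ∧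
          |((S.pt m' N t).2.2 - (S.pt m N t).2.2) - ((S.pt m' N t').2.2 - (S.pt m N t').2.2)| ≤
            D / L * |(S.pt m' N t').2.1 - (S.pt m N t').2.1| := by
  obtain ⟨c, hc, r₀, hr₀, hcross⟩ := b.exists_crossing hS hT
  have hTn := b.T_nonneg
  have hB := b.B_pos
  have hK := zero_lt_one.trans_le b.one_le_K
  refine ⟨2 * b.T * (b.K * (2 * π) * b.B) / c, by positivity, fun L hL s hs m hp => ?_⟩
  have hη : ∀ x, b.μ ≤ deriv S.η x := fun x => by
    rw [← hS.dxx_eq (P := (x, 0, 0)) (IsSolenoid.mem_cover_zero x)]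
    exact b.le_dxx _ (b.zero_mem_slab x)
  have hsmall : ∀ᶠ N : ℕ in atTop, L * b.μ⁻¹ ^ (N + 1) < r₀ := by
    have h := ((tendsto_pow_atTop_nhds_zero_of_lt_one b.μ_inv_pos.le b.μ_inv_lt).comp
      (tendsto_add_atTop_nat 1)).const_mul L
    rw [mul_zero] at h
    exact h.eventually_lt_const hr₀
  filter_upwards [b.eventually_of_strongLip hS hs hp, hsmall] with N hN hNr m' hag hne
  set E := ∏ k ∈ Finset.range (N + 1), deriv S.η (S.G m k s) with hE
  have hEμ : b.μ ^ (N + 1) ≤ E := by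
    have := Finset.prod_le_prod (s := Finset.range (N + 1)) (f := fun _ => b.μ)
      (g := fun k => deriv S.η (S.G m k s)) (fun _ _ => b.μ_pos.le) (fun k _ => hη _)
    simpa using this
  have hE0 : 0 < E := (pow_pos b.μ_pos _).trans_le hEμ
  have hr0 : 0 < L * E⁻¹ := by positivity
  have hrr : L * E⁻¹ ≤ r₀ := by
    refine le_trans ?_ hNr.le
    rw [inv_pow]
    have := b.μ_pos
    gcongr
  have hlow : ∀ t' ∈ Icc 0 (2 * π), c * (L * E⁻¹) ≤
      |(S.pt m' N t').2.1 - (S.pt m N t').2.1| := by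
    intro t' ht'
    by_contra! hlt
    rw [abs_sub_comm, pt, pt, ← G_congr hag] at hlt
    obtain ⟨t, ht, he⟩ := hcross (shift N m) (shift N m') hne _ _ hr0 hrr hlt
    have hGm := G_mem_Icc hS m N ht'
    have h1 := abs_lt.1 ht
    have h2 := hN m' hne _ rfl t ⟨by linarith [hGm.1], by linarith [hGm.2]⟩ he t' ht'
    rw [abs_sub_comm] at h2
    linarith
  intro t ht t' ht'
  have hlen : |S.G m N t - S.G m N t'| ≤ b.K * (2 * π) * b.B * E⁻¹ := by
    have h1 := b.abs_G_sub_mul_prod_le hS m N ⟨hs.1, hs.2.le⟩ ht ht'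
    rw [← div_eq_mul_inv, le_div_iff₀ hE0, hE, Finset.prod_range_succ', ← mul_assoc]
    have h2 : deriv S.η (S.G m 0 s) ≤ b.B := by
      rw [← hS.dxx_eq (P := (S.G m 0 s, 0, 0)) (IsSolenoid.mem_cover_zero _)]
      exact (le_abs_self _).trans (b.xx.abs_le _ (b.zero_mem_slab _))
    have h3 : 0 ≤ deriv S.η (S.G m 0 s) := b.μ_pos.le.trans (hη _)
    gcongr
  have hfin : 2 * (b.T * |S.G m N t - S.G m N t'|) ≤
      2 * b.T * (b.K * (2 * π) * b.B) / c / L * |(S.pt m' N t').2.1 - (S.pt m N t').2.1| := by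
    calc _ ≤ 2 * (b.T * (b.K * (2 * π) * b.B * E⁻¹)) := by gcongr
      _ = 2 * b.T * (b.K * (2 * π) * b.B) / c / L * (c * (L * E⁻¹)) := by field_simp
      _ ≤ _ := by
        have := hlow t' ht'
        gcongr
  have hg1 := b.gap_line_le hS (shift N m) (S.G m N t) (S.G m N t')
  have hg2 := b.gap_line_le hS (shift N m') (S.G m N t) (S.G m N t')
  have a1 := (b.abs_fst_le_gap _ _).trans hg1
  have a2 := (b.abs_fst_le_gap _ _).trans hg2
  have a3 := (b.abs_snd_le_gap _ _).trans hg1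
  have a4 := (b.abs_snd_le_gap _ _).trans hg2
  refine ⟨le_trans ?_ hfin, le_trans ?_ hfin⟩
  · simp only [pt, ← G_congr hag]
    rw [sub_sub_sub_comm]
    exact (abs_sub _ _).trans (by linarith)
  · simp only [pt, ← G_congr hag]
    rw [sub_sub_sub_comm]
    exact (abs_sub _ _).trans (by linarith)

end Bounds

/-! ### Holonomies -/

namespace Bounds

theorem discDist_line (m m' : ℕ → Fin S.d) (t : ℝ) :
    discDist (S.line m t) (S.line m' t) =
      √(((S.pt m' 0 t).2.1 - (S.pt m 0 t).2.1) ^ 2 +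
        ((S.pt m' 0 t).2.2 - (S.pt m 0 t).2.2) ^ 2) := by
  rw [discDist, pt_zero, pt_zero, sub_sq_comm, sub_sq_comm (S.line m t).2.2]

/-- The differences of two lines at consecutive preimages, up to the level at which the codes
separate. -/
theorem pt_sub (b : Bounds S) (hS : S.IsSolenoid) {m m' : ℕ → Fin S.d} {N : ℕ}
    (h : ∀ j < N, m j = m' j) (t : ℝ) {j : ℕ} (hj : j < N) :
    (S.pt m' j t).2.1 - (S.pt m j t).2.1 =
      segAvg S.dyy (S.pt m (j + 1) t) (S.pt m' (j + 1) t) *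
        ((S.pt m' (j + 1) t).2.1 - (S.pt m (j + 1) t).2.1) ∧
    (S.pt m' j t).2.2 - (S.pt m j t).2.2 =
      segAvg S.dzy (S.pt m (j + 1) t) (S.pt m' (j + 1) t) *
        ((S.pt m' (j + 1) t).2.1 - (S.pt m (j + 1) t).2.1) +
      segAvg S.dzz (S.pt m (j + 1) t) (S.pt m' (j + 1) t) *
        ((S.pt m' (j + 1) t).2.2 - (S.pt m (j + 1) t).2.2) := by
  obtain ⟨-, h1, h2⟩ := hS.lift_sub b (b.pt_mem_slab hS m (j + 1) t) (b.pt_mem_slab hS m' (j + 1) t)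
  have h3 : (S.pt m' (j + 1) t).1 - (S.pt m (j + 1) t).1 = 0 :=
    sub_eq_zero.2 (G_congr (fun i hi => (h i (by omega)).symm) t)
  rw [b.lift_pt hS, b.lift_pt hS, h3, mul_zero, zero_add] at h1 h2
  exact ⟨h1, h2⟩

/-- Two points in one disc whose lines have the same code coincide; for the other points of a
horizontal cylinder of large generation, the bi-Lipschitz inequalities are checked at the level at
which the codes separate. -/
theorem exists_holBiLipAt (b : Bounds S) (hS : S.IsSolenoid) {L s : ℝ} (hL : 0 < L)
    (hs : s ∈ Ico 0 (2 * π)) {m : ℕ → Fin S.d}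
    (h : ∀ᶠ N : ℕ in atTop, ∀ m' : ℕ → Fin S.d, (∀ j < N, m j = m' j) → m N ≠ m' N →
      ∀ t ∈ Icc 0 (2 * π), ∀ t' ∈ Icc 0 (2 * π),
        discDist (S.line m t) (S.line m' t) ≤ L * discDist (S.line m t') (S.line m' t')) :
    ∃ n, S.HolBiLipAt L n (S.line m s) := by
  obtain ⟨n, hn⟩ := eventually_atTop.1 h
  have hrep : rep (S.line m s).1 = s := by rw [b.line_fst hS, rep_coe_of_mem hs]
  refine ⟨n, fun t ht p' hp' => ?_⟩
  have hfst : p'.1 = (s : Circ) := hp'.1.1.2.trans (b.line_fst hS m s)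
  obtain ⟨m', rfl⟩ := b.exists_line_eq hS hp'.2 hfst
  have hag := (b.line_mem_H_iff hS m m' hs n).1 hp'.1.2
  rw [hrep, b.hol_line hS, b.hol_line hS]
  by_cases hmm : m = m'
  · subst hmm
    simp [discDist]
  · have hex : ∃ j, m j ≠ m' j := Function.ne_iff.1 hmm
    classical
    have hspec := Nat.find_spec hex
    have hmin : ∀ j < Nat.find hex, m j = m' j := fun j hj => not_not.1 (Nat.find_min hex hj)
    have hle : n ≤ Nat.find hex := by
      by_contra! hlt
      exact hspec (hag _ hlt.le)
    have hs' : s ∈ Icc 0 (2 * π) := ⟨hs.1, hs.2.le⟩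
    refine ⟨?_, hn _ hle m' hmin hspec t ht s hs'⟩
    rw [inv_mul_le_iff₀ hL]
    exact hn _ hle m' hmin hspec s hs' t ht

/-- Combination of the estimates for the components of the difference of two lines, at two points
of the base: `a, c` are the products of diagonal entries, and `u', v'` are the differences at the
level at which the codes separate. -/
theorem abs_le_of_transport {K E ε : ℝ} (hE : 0 ≤ E) (hε : 0 ≤ ε)
    {a₁ a₂ c₁ c₂ u₁ u₂ v₁ v₂ u₁' u₂' v₁' v₂' : ℝ} (ha₁ : 0 ≤ a₁) (hc₁ : 0 ≤ c₁) (hc₂ : 0 ≤ c₂)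
    (ha : a₁ ≤ K * a₂) (hc : c₁ ≤ K * c₂) (hca : c₂ ≤ a₂) (hK : 0 ≤ K)
    (hu₁ : u₁ = a₁ * u₁') (hu₂ : u₂ = a₂ * u₂') (hv₁ : |v₁ - c₁ * v₁'| ≤ E * |u₁|)
    (hv₂ : |v₂ - c₂ * v₂'| ≤ E * |u₂|) (hu : |u₁' - u₂'| ≤ ε * |u₂'|)
    (hv : |v₁' - v₂'| ≤ ε * |u₂'|) :
    |u₁| ≤ K * (1 + ε) * |u₂| ∧
      |v₁| ≤ K * |v₂| + (K * E + K * ε + E * (K * (1 + ε))) * |u₂| := by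
  have ha₂ : 0 ≤ a₂ := hc₂.trans hca
  have h1 : |u₁'| ≤ (1 + ε) * |u₂'| := by
    have := abs_sub_abs_le_abs_sub u₁' u₂'
    linarith
  have h2 : |u₂| = a₂ * |u₂'| := by rw [hu₂, abs_mul, abs_of_nonneg ha₂]
  have h3 : |u₁| ≤ K * (1 + ε) * |u₂| := by
    rw [hu₁, abs_mul, abs_of_nonneg ha₁, h2]
    calc a₁ * |u₁'| ≤ K * a₂ * ((1 + ε) * |u₂'|) := by gcongr
      _ = _ := by ring
  refine ⟨h3, ?_⟩
  have h4 : |v₁| ≤ c₁ * |v₁'| + E * |u₁| := by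
    have := abs_sub_abs_le_abs_sub v₁ (c₁ * v₁')
    rw [abs_mul, abs_of_nonneg hc₁] at this
    linarith
  have h5 : c₂ * |v₂'| ≤ |v₂| + E * |u₂| := by
    have := abs_sub_abs_le_abs_sub (c₂ * v₂') v₂
    rw [abs_mul, abs_of_nonneg hc₂, abs_sub_comm] at this
    linarith
  have h6 : |v₁'| ≤ |v₂'| + ε * |u₂'| := by
    have := abs_sub_abs_le_abs_sub v₁' v₂'
    linarith
  calc |v₁| ≤ K * c₂ * (|v₂'| + ε * |u₂'|) + E * (K * (1 + ε) * |u₂|) :=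
        h4.trans (by gcongr)
    _ = K * (c₂ * |v₂'|) + K * ε * (c₂ * |u₂'|) + E * (K * (1 + ε) * |u₂|) := by ring
    _ ≤ K * (|v₂| + E * |u₂|) + K * ε * (a₂ * |u₂'|) + E * (K * (1 + ε) * |u₂|) := by gcongr
    _ = _ := by rw [h2]; ring

/-- Every strong Lipschitz constant gives a bi-Lipschitz constant of the holonomies. -/
theorem exists_biLip (b : Bounds S) (hS : S.IsSolenoid) (hT : S.Transversal) {L₁ : ℝ}
    (hL₁ : 0 < L₁) : ∃ L₂ : ℝ, 1 ≤ L₂ ∧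
      ∀ p : Pt, S.StrongLip L₁ p → ∃ n : ℕ, S.HolBiLipAt L₂ n p := by
  obtain ⟨D, hD, hvar⟩ := b.exists_relative_variation hS hT
  have hK := b.one_le_K
  have hK0 := zero_le_one.trans hK
  have hB := b.B_pos.le
  set E := b.B / (b.a₀ * (1 - b.κ)) with hEdef
  have hκ : 0 < 1 - b.κ := by linarith [b.κ_lt]
  have hE : 0 ≤ E := by have := b.a₀_pos; positivity
  set ε := D / L₁
  have hε : 0 ≤ ε := by positivity
  have hL2 : 1 ≤ K b * (1 + ε) + (K b + (K b * E + K b * ε + E * (K b * (1 + ε)))) := by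
    have h1 : 0 ≤ K b * E + K b * ε + E * (K b * (1 + ε)) := by positivity
    have h2 : 0 ≤ K b * (1 + ε) := by positivity
    linarith
  refine ⟨_, hL2, fun p hp => ?_⟩
  have hs := rep_mem p.1
  obtain ⟨m, hm⟩ := b.exists_line_eq hS hp.1 (coe_rep p.1).symm
  rw [← hm] at hp ⊢
  refine b.exists_holBiLipAt hS (zero_lt_one.trans_le hL2) hs ?_
  filter_upwards [hvar L₁ hL₁ _ hs m hp] with N hN m' hag hne t ht t' ht'
  obtain ⟨hu, hv⟩ := hN m' hag hne t ht t' ht'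
  have hsl := b.pt_mem_slab hS
  have hα := b.α_pos
  have hu0 : ∀ τ, _ := fun τ => eq_prod_mul (N := N)
    (u := fun j => (S.pt m' j τ).2.1 - (S.pt m j τ).2.1)
    (a := fun j => segAvg S.dyy (S.pt m (j + 1) τ) (S.pt m' (j + 1) τ))
    fun j hj => (b.pt_sub hS hag τ hj).1
  have hv0 : ∀ τ, _ := fun τ => abs_sub_prod_mul_le b.a₀_pos b.κ_lt hB (N := N)
    (fun j hj => (b.pt_sub hS hag τ hj).1) (fun j hj => (b.pt_sub hS hag τ hj).2)
    (fun j _ => b.yy.le_segAvg hα (hsl _ _ _) (hsl _ _ _) b.le_dyy)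
    (fun j _ => b.zy.abs_segAvg_le hα (hsl _ _ _) (hsl _ _ _))
    (fun j _ => b.c₀_pos.le.trans (b.zz.le_segAvg hα (hsl _ _ _) (hsl _ _ _) b.le_dzz))
    (fun j _ => b.zz.segAvg_le_mul b.yy hα (hsl _ _ _) (hsl _ _ _) b.dzz_le)
  have hlowy : ∀ P ∈ slab b.ρ, b.low ≤ S.dyy P := fun P hP =>
    ((min_le_right _ _).trans (min_le_left _ _)).trans (b.le_dyy P hP)
  have hlowz : ∀ P ∈ slab b.ρ, b.low ≤ S.dzz P := fun P hP =>
    ((min_le_right _ _).trans (min_le_right _ _)).trans (b.le_dzz P hP)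
  have hdist : ∀ (m : ℕ → Fin S.d) (k : ℕ), _ := fun m k => b.dist_pt_le_pow hS m k ht ht'
  have hay := b.prod_segAvg_le b.yy hlowy (N := N) (fun k => hsl m k t) (fun k => hsl m' k t)
    (fun k => hsl m k t') (fun k => hsl m' k t') (hdist m) (hdist m')
  have haz := b.prod_segAvg_le b.zz hlowz (N := N) (fun k => hsl m k t) (fun k => hsl m' k t)
    (fun k => hsl m k t') (fun k => hsl m' k t') (hdist m) (hdist m')
  have hypos : ∀ τ, 0 ≤ ∏ k ∈ Finset.range N,
      segAvg S.dyy (S.pt m (k + 1) τ) (S.pt m' (k + 1) τ) := fun τ =>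
    Finset.prod_nonneg fun k _ => b.a₀_pos.le.trans
      (b.yy.le_segAvg hα (hsl _ _ _) (hsl _ _ _) b.le_dyy)
  have hzpos : ∀ τ (k : ℕ), 0 ≤ segAvg S.dzz (S.pt m (k + 1) τ) (S.pt m' (k + 1) τ) := fun τ k =>
    b.c₀_pos.le.trans (b.zz.le_segAvg hα (hsl _ _ _) (hsl _ _ _) b.le_dzz)
  have hzy : ∏ k ∈ Finset.range N, segAvg S.dzz (S.pt m (k + 1) t') (S.pt m' (k + 1) t') ≤
      ∏ k ∈ Finset.range N, segAvg S.dyy (S.pt m (k + 1) t') (S.pt m' (k + 1) t') := by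
    refine Finset.prod_le_prod (fun k _ => hzpos t' k) fun k _ => ?_
    have h1 := b.zz.segAvg_le_mul b.yy hα (hsl m (k + 1) t') (hsl m' (k + 1) t') b.dzz_le
    have h2 := b.yy.le_segAvg hα (hsl m (k + 1) t') (hsl m' (k + 1) t') b.le_dyy
    nlinarith [b.κ_lt, b.a₀_pos]
  obtain ⟨r1, r2⟩ := abs_le_of_transport hE hε (hypos t) (Finset.prod_nonneg fun k _ => hzpos t k)
    (Finset.prod_nonneg fun k _ => hzpos t' k) hay haz hzy hK0 (hu0 t) (hu0 t') (hv0 t) (hv0 t')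
    hu hv
  rw [discDist_line, discDist_line]
  generalize (S.pt m' 0 t).2.1 - (S.pt m 0 t).2.1 = u₁ at *
  generalize (S.pt m' 0 t).2.2 - (S.pt m 0 t).2.2 = v₁ at *
  generalize (S.pt m' 0 t').2.1 - (S.pt m 0 t').2.1 = u₂ at *
  generalize (S.pt m' 0 t').2.2 - (S.pt m 0 t').2.2 = v₂ at *
  have e1 : |u₂| ≤ √(u₂ ^ 2 + v₂ ^ 2) := Real.abs_le_sqrt (by nlinarith)
  have e2 : |v₂| ≤ √(u₂ ^ 2 + v₂ ^ 2) := Real.abs_le_sqrt (by nlinarith)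
  have e3 : √(u₁ ^ 2 + v₁ ^ 2) ≤ |u₁| + |v₁| := by
    rw [Real.sqrt_le_left (by positivity), add_sq, sq_abs, sq_abs]
    nlinarith [mul_nonneg (abs_nonneg u₁) (abs_nonneg v₁)]
  calc _ ≤ |u₁| + |v₁| := e3
    _ ≤ K b * (1 + ε) * |u₂| + (K b * |v₂| +
        (K b * E + K b * ε + E * (K b * (1 + ε))) * |u₂|) := add_le_add r1 r2
    _ ≤ K b * (1 + ε) * √(u₂ ^ 2 + v₂ ^ 2) + (K b * √(u₂ ^ 2 + v₂ ^ 2) +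
        (K b * E + K b * ε + E * (K b * (1 + ε))) * √(u₂ ^ 2 + v₂ ^ 2)) := by gcongr
    _ = _ := by ring

/-- In the linear diagonal case the transport of differences is exact and the same over all points
of the base, so that only the relative variation at the separation level enters. -/
theorem exists_biLip_of_isLinear (b : Bounds S) (hS : S.IsSolenoid) (hT : S.Transversal)
    (hlin : S.IsLinear) {L₂ : ℝ} (hL₂ : 1 < L₂) : ∃ L₁ : ℝ, 0 < L₁ ∧
      ∀ p : Pt, S.StrongLip L₁ p → ∃ n : ℕ, S.HolBiLipAt L₂ n p := by
  obtain ⟨D, hD, hvar⟩ := b.exists_relative_variation hS hT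
  obtain ⟨-, l, n, hln⟩ := hlin
  have h0 : ((0 : ℝ), (0 : ℝ), (0 : ℝ)) ∈ cover := IsSolenoid.mem_cover_zero 0
  have hl : deriv (S.lam 0) 0 = l := by
    have : S.lam 0 =ᶠ[𝓝 0] fun y => l * y := by
      have hc : Continuous fun y : ℝ => ((0 : ℝ), y, (0 : ℝ)) := by fun_prop
      filter_upwards [hc.continuousAt.preimage_mem_nhds (isOpen_cover.mem_nhds h0)] with y hy
      exact (hln _ _ _ hy).1
    rw [this.deriv_eq]
    simp
  have hn : deriv (S.nu 0 0) 0 = n := by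
    have : S.nu 0 0 =ᶠ[𝓝 0] fun z => n * z := by
      have hc : Continuous fun z : ℝ => ((0 : ℝ), (0 : ℝ), z) := by fun_prop
      filter_upwards [hc.continuousAt.preimage_mem_nhds (isOpen_cover.mem_nhds h0)] with z hz
      exact (hln _ _ _ hz).2
    rw [this.deriv_eq]
    simp
  have hn0 : 0 < n := hn ▸ hS.nu_pos 0 0 0 h0
  have hnl : n < l := hn ▸ hl ▸ hS.nu_lt_lam 0 0 0 h0
  -- `L₁` makes the relative variation `D / L₁` at most `(L₂ - 1) / 2`
  have hL₁ : 0 < 2 * D / (L₂ - 1) + 1 := by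
    have : 0 < L₂ - 1 := by linarith
    positivity
  refine ⟨_, hL₁, fun p hp => ?_⟩
  set L₁ := 2 * D / (L₂ - 1) + 1 with hL₁def
  have hε : 1 + 2 * (D / L₁) ≤ L₂ := by
    have h1 : 0 < L₂ - 1 := by linarith
    have h2 : 2 * D ≤ (L₂ - 1) * L₁ := by
      rw [hL₁def, mul_add, mul_div_cancel₀ _ h1.ne']; linarith
    have h3 : 2 * (D / L₁) ≤ L₂ - 1 := by
      rw [← mul_div_assoc, div_le_iff₀ hL₁]; exact h2
    linarith
  have hs := rep_mem p.1
  obtain ⟨m, hm⟩ := b.exists_line_eq hS hp.1 (coe_rep p.1).symm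
  rw [← hm] at hp ⊢
  refine b.exists_holBiLipAt hS (by linarith) hs ?_
  filter_upwards [hvar L₁ hL₁ _ hs m hp] with N hN m' hag hne t ht t' ht'
  obtain ⟨hu, hv⟩ := hN m' hag hne t ht t' ht'
  have hcov : ∀ m k τ, S.pt m k τ ∈ cover := fun m k τ =>
    slab_subset_cover b.ρ_nonneg b.ρ_lt (b.pt_mem_slab hS m k τ)
  have hstep : ∀ τ, ∀ j < N,
      (S.pt m' j τ).2.1 - (S.pt m j τ).2.1 =
        l * ((S.pt m' (j + 1) τ).2.1 - (S.pt m (j + 1) τ).2.1) ∧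
      (S.pt m' j τ).2.2 - (S.pt m j τ).2.2 =
        n * ((S.pt m' (j + 1) τ).2.2 - (S.pt m (j + 1) τ).2.2) := by
    intro τ j hj
    have h3 : (S.pt m' (j + 1) τ).1 = (S.pt m (j + 1) τ).1 :=
      G_congr (fun i hi => (hag i (by omega)).symm) τ
    have h4 := hln (S.pt m (j + 1) τ).1 (S.pt m (j + 1) τ).2.1 (S.pt m (j + 1) τ).2.2
      (hcov m (j + 1) τ)
    have h5 := hln (S.pt m' (j + 1) τ).1 (S.pt m' (j + 1) τ).2.1 (S.pt m' (j + 1) τ).2.2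
      (hcov m' (j + 1) τ)
    rw [← b.lift_pt hS, ← b.lift_pt hS]
    simp only [lift]
    rw [h4.1, h4.2, h5.1, h5.2, h3]
    constructor <;> ring
  have hu0 : ∀ τ, _ := fun τ => eq_prod_mul (N := N) (a := fun _ => l)
    (u := fun j => (S.pt m' j τ).2.1 - (S.pt m j τ).2.1) fun j hj => (hstep τ j hj).1
  have hv0 : ∀ τ, _ := fun τ => eq_prod_mul (N := N) (a := fun _ => n)
    (u := fun j => (S.pt m' j τ).2.2 - (S.pt m j τ).2.2) fun j hj => (hstep τ j hj).2
  simp only [Finset.prod_const, Finset.card_range] at hu0 hv0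
  have hε0 : 0 ≤ D / L₁ := by positivity
  have hl0 : 0 < l := hn0.trans hnl
  have hpow : n ^ N ≤ l ^ N := pow_le_pow_left₀ hn0.le hnl.le N
  rw [discDist_line, discDist_line]
  have hu1 := hu0 t
  have hu2 := hu0 t'
  have hv1 := hv0 t
  have hv2 := hv0 t'
  generalize (S.pt m' 0 t).2.1 - (S.pt m 0 t).2.1 = u₁ at *
  generalize (S.pt m' 0 t).2.2 - (S.pt m 0 t).2.2 = v₁ at *
  generalize (S.pt m' 0 t').2.1 - (S.pt m 0 t').2.1 = u₂ at *
  generalize (S.pt m' 0 t').2.2 - (S.pt m 0 t').2.2 = v₂ at *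
  have hdu : |u₁ - u₂| ≤ D / L₁ * |u₂| := by
    rw [hu1, hu2, ← mul_sub, abs_mul, abs_mul, abs_of_pos (pow_pos hl0 N), mul_left_comm]
    gcongr
  have hdv : |v₁ - v₂| ≤ D / L₁ * |u₂| := by
    rw [hv1, hv2, hu2, ← mul_sub, abs_mul, abs_mul, abs_of_pos (pow_pos hl0 N),
      abs_of_pos (pow_pos hn0 N), mul_left_comm (D / L₁)]
    exact mul_le_mul hpow hv (abs_nonneg _) (pow_pos hl0 N).le
  set R := √(u₂ ^ 2 + v₂ ^ 2) with hR
  have hR0 : 0 ≤ R := Real.sqrt_nonneg _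
  have hRsq : R ^ 2 = u₂ ^ 2 + v₂ ^ 2 := Real.sq_sqrt (by positivity)
  have e1 : |u₂| ≤ R := Real.abs_le_sqrt (by nlinarith)
  have e2 : |v₂| ≤ R := Real.abs_le_sqrt (by nlinarith)
  have hmul : D / L₁ * |u₂| ≤ D / L₁ * R := by gcongr
  have b1 : |u₁| ≤ |u₂| + D / L₁ * R := by linarith [abs_sub_abs_le_abs_sub u₁ u₂]
  have b2 : |v₁| ≤ |v₂| + D / L₁ * R := by linarith [abs_sub_abs_le_abs_sub v₁ v₂]
  refine le_trans ?_ (mul_le_mul_of_nonneg_right hε hR0)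
  generalize D / L₁ = ε at *
  rw [Real.sqrt_le_left (by positivity)]
  have c1 := pow_le_pow_left₀ (abs_nonneg u₁) b1 2
  have c2 := pow_le_pow_left₀ (abs_nonneg v₁) b2 2
  rw [sq_abs, add_sq, sq_abs] at c1 c2
  have d1 := mul_le_mul_of_nonneg_right e1 (mul_nonneg hε0 hR0)
  have d2 := mul_le_mul_of_nonneg_right e2 (mul_nonneg hε0 hR0)
  nlinarith [mul_nonneg (sq_nonneg ε) (sq_nonneg R)]

/-- Points of the solenoid that are close to `p` in its disc lie in a given horizontal cylinder of
`p`. -/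
theorem exists_mem_H (b : Bounds S) (hS : S.IsSolenoid) {p : Pt} (hp : p ∈ S.Lam) (n : ℕ) :
    ∃ δ > 0, ∀ p' ∈ Ws p.1 ∩ S.Lam, discDist p p' < δ → p' ∈ S.H n p := by
  obtain ⟨δ₀, hδ₀, hsep⟩ := b.exists_separation hS
  have hs := rep_mem p.1
  have hnear : ∀ᶠ p' in 𝓝[S.Lam] p, ∀ k ∈ Finset.range (n + 2),
      dist (S.back k p').1 (S.back k p).1 < δ₀ := by
    rw [Filter.eventually_all_finset]
    intro k _
    exact (continuous_fst.comp_continuousOn (b.continuousOn_back hS k) p hp).eventually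
      (Metric.ball_mem_nhds _ hδ₀)
  obtain ⟨δ, hδ, hball⟩ := Metric.mem_nhdsWithin_iff.1 hnear
  refine ⟨δ, hδ, fun p' hp' hd => ?_⟩
  have hfst : p'.1 = p.1 := hp'.1.2
  have hdist : dist p' p < δ := by
    refine lt_of_le_of_lt ?_ hd
    rw [Prod.dist_eq, Prod.dist_eq, hfst, dist_self, Real.dist_eq, Real.dist_eq]
    refine max_le (Real.sqrt_nonneg _) (max_le ?_ ?_)
    · rw [abs_sub_comm]; exact Real.abs_le_sqrt (by nlinarith [sq_nonneg (p.2.2 - p'.2.2)])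
    · rw [abs_sub_comm]; exact Real.abs_le_sqrt (by nlinarith [sq_nonneg (p.2.1 - p'.2.1)])
  have hclose := hball ⟨hdist, hp'.2⟩
  have heq : ∀ k ≤ n + 1, (S.back k p').1 = (S.back k p).1 := by
    intro k hk
    induction k with
    | zero => exact hfst
    | succ k ih =>
      refine hsep _ _ ?_ (hclose (k + 1) (Finset.mem_range.2 (by omega)))
      rw [← f_fst, ← f_fst, hS.f_back k hp'.2, hS.f_back k hp]
      exact ih (by omega)
  obtain ⟨m, hm⟩ := b.exists_line_eq hS hp (coe_rep p.1).symm
  obtain ⟨m', hm'⟩ := b.exists_line_eq hS hp'.2 (hfst.trans (coe_rep p.1).symm)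
  have hiff := b.line_mem_H_iff hS m m' hs n
  rw [hm, hm'] at hiff
  refine hiff.2 fun j hj => ?_
  have h1 := heq (j + 1) (by omega)
  have h2 := (b.back_line_mem_arc_iff hS m j hs (m j)).2 rfl
  rw [hm, ← h1, ← hm'] at h2
  exact ((b.back_line_mem_arc_iff hS m' j hs (m j)).1 h2).symm

/-- The strong bi-Lipschitz condition depends only on the arc of the unstable line over
`[0, 2π]`, so that the holonomies preserve it. -/
theorem hol_mem_Ls (b : Bounds S) (hS : S.IsSolenoid) {x x' : Circ} {p : Pt}
    (hp : p ∈ S.Ls ∩ Ws x) :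
    S.hol (rep x) (rep x') p ∈ S.Ls ∩ Ws x' ∧
      S.hol (rep x') (rep x) (S.hol (rep x) (rep x') p) = p := by
  obtain ⟨⟨L, hL, hp1⟩, hpM, hpx⟩ := hp
  obtain ⟨m, rfl⟩ := b.exists_line_eq hS hp1.1.1 (hpx.trans (coe_rep x).symm)
  rw [b.hol_line hS, b.hol_line hS]
  have hx := rep_mem x
  have hx' := rep_mem x'
  have harc : ∀ y : Circ, S.WuArc (S.line m (rep y)) 0 (2 * π) =
      {t | t.1 ∈ Icc 0 (2 * π) ∧ S.line m t.1 = t.2} := by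
    intro y
    have hrep : rep (S.line m (rep y)).1 = rep y := by rw [b.line_fst hS, coe_rep]
    ext t
    simp only [WuArc, hrep, mem_ofPred_eq]
    refine and_congr_right fun _ => ⟨?_, fun h => ⟨_, b.isUnstableLine_line hS m, rfl, h⟩⟩
    rintro ⟨γ, hγ, h1, h2⟩
    rw [← h2, b.eq_line_of_isUnstableLine hS hγ h1]
  refine ⟨⟨⟨L, hL, ?_, ?_⟩, hS.Lam_subset_M (b.line_mem hS _ _), ?_⟩, rfl⟩
  · refine hp1.2 (rep x', S.line m (rep x')) ?_
    rw [harc]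
    exact ⟨⟨hx'.1, hx'.2.le⟩, rfl⟩
  · rw [harc, ← harc x]
    exact hp1.2
  · rw [b.line_fst hS, coe_rep]

end Bounds

end TriMap

end Solenoid

end

theorem mainTheorem6 (S : Solenoid.TriMap) (hS : S.IsSolenoid) (hT : S.Transversal) :
    -- through every point of the solenoid passes exactly one unstable line
    (∀ (s : ℝ) (v : Solenoid.Pt), v ∈ S.Lam → v.1 = (s : Solenoid.Circ) →
      ∃! γ : ℝ → Solenoid.Pt, S.IsUnstableLine γ ∧ γ s = v) ∧
    -- for every admissible `L₂` there is `L₁`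
    (∃ C : ℝ, 1 ≤ C ∧ (S.IsLinear → C = 1) ∧ ∀ L₂ : ℝ, C < L₂ → ∃ L₁ : ℝ, 0 < L₁ ∧
      ∀ p : Solenoid.Pt, S.StrongLip L₁ p → ∃ n : ℕ, S.HolBiLipAt L₂ n p) ∧
    -- for every `L₁` there is `L₂`
    (∀ L₁ : ℝ, 0 < L₁ → ∃ L₂ : ℝ, 1 ≤ L₂ ∧
      ∀ p : Solenoid.Pt, S.StrongLip L₁ p → ∃ n : ℕ, S.HolBiLipAt L₂ n p) ∧
    -- the holonomies map `L^s_x` onto `L^s_{x'}`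
    (∀ x x' : Solenoid.Circ,
      S.hol (Solenoid.rep x) (Solenoid.rep x') '' (S.Ls ∩ Solenoid.Ws x) =
        S.Ls ∩ Solenoid.Ws x') ∧
    -- the holonomies are locally Lipschitz on `L^s`
    (∀ p ∈ S.Ls, ∃ K > 0, ∃ δ > 0, ∀ x' : Solenoid.Circ, ∀ p' ∈ Solenoid.Ws p.1 ∩ S.Lam,
      Solenoid.discDist p p' < δ →
        Solenoid.discDist (S.hol (Solenoid.rep p.1) (Solenoid.rep x') p)
            (S.hol (Solenoid.rep p.1) (Solenoid.rep x') p') ≤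
          K * Solenoid.discDist p p') := by
  obtain ⟨b⟩ := hS.exists_bounds
  refine ⟨fun s v hv hs => b.existsUnique_isUnstableLine hS hv hs, ?_,
    fun L₁ hL₁ => b.exists_biLip hS hT hL₁, fun x x' => ?_, ?_⟩
  · by_cases hlin : S.IsLinear
    · exact ⟨1, le_rfl, fun _ => rfl, fun L₂ hL₂ => b.exists_biLip_of_isLinear hS hT hlin hL₂⟩
    · -- any bi-Lipschitz constant that works for `L₁ = 1` may serve as `C`
      obtain ⟨C, hC, h⟩ := b.exists_biLip hS hT one_pos
      refine ⟨C, hC, fun h => absurd h hlin, fun L₂ hL₂ => ⟨1, one_pos, fun p hp => ?_⟩⟩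
      obtain ⟨n, hn⟩ := h p hp
      have hC0 : 0 < C := one_pos.trans_le hC
      refine ⟨n, fun t ht p' hp' => ?_⟩
      obtain ⟨h1, h2⟩ := hn t ht p' hp'
      have hd : 0 ≤ Solenoid.discDist p p' := Real.sqrt_nonneg _
      exact ⟨le_trans (by gcongr) h1, h2.trans (by gcongr)⟩
  · refine Subset.antisymm ?_ fun q hq => ?_
    · rintro _ ⟨p, hp, rfl⟩
      exact (b.hol_mem_Ls hS hp).1
    · have h := b.hol_mem_Ls hS (x' := x) hq
      exact ⟨_, h.1, h.2⟩
  · rintro p ⟨L, hL, hp, -⟩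
    obtain ⟨K, hK, h⟩ := b.exists_biLip hS hT hL
    obtain ⟨n, hn⟩ := h p hp
    obtain ⟨δ, hδ, hH⟩ := b.exists_mem_H hS hp.1 n
    refine ⟨K, one_pos.trans_le hK, δ, hδ, fun x' p' hp' hd => ?_⟩
    have hx' := Solenoid.rep_mem x'
    exact (hn _ ⟨hx'.1, hx'.2.le⟩ p' ⟨⟨hp'.1, hH p' hp' hd⟩, hp'.2⟩).2
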